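/- Let $\mathbb{K}$ be $\mathbb{R}$ or $\mathbb{C}$, let $M$ be a smooth (Hausdorff, finite-dimensional) manifold, and let $\mathrm{UConf}(M)=\bigsqcup_{k\ge 0}\mathrm{UConf}_k(M)$ be its unordered configuration space: the set of finite subsets of $M$, with $\mathrm{UConf}_k(M)=\mathrm{OConf}_k(M)/S_k$, where $\mathrm{OConf}_k(M)\subset M^k$ is the open submanifold of tuples of distinct points. "Vector bundle" means smooth $\mathbb{K}$-vector bundle, possibly of (ind-finite) infinite rank and with a rank that may depend on the component; bundle maps are smooth, fibrewise linear and cover the identity. For vector bundles $\mathbf V,\mathbf W$ on $\mathrm{UConf}(M)$, the Hadamard product $\mathbf V\otimes\mathbf W$ is the usual tensor product, with unit $\mathbf I_\otimes=\mathrm{UConf}(M)\times\mathbb K$. The Cauchy product $\mathbf V\boxtimes\mathbf W$ has the fibres $(\mathbf V\boxtimes\mathbf W)_{\underline x}=\bigoplus_{\underline x=\underline x'\sqcup\underline x''}\mathbf V_{\underline x'}\otimes\mathbf W_{\underline x''}$ (sum over ordered splits) and the smooth structure whose pullback to $\mathrm{OConf}_k(M)$ is the corresponding direct sum of external tensor products.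 Its unit $\mathbf I_\boxtimes$ is $\mathbb K$ over the empty configuration and $0$ elsewhere. Let $\mu:\mathbf I_\otimes\boxtimes\mathbf I_\otimes\to\mathbf I_\otimes$ be the multiplication of scalars on each summand, $\Delta:\mathbf I_\boxtimes\to\mathbf I_\boxtimes\otimes\mathbf I_\boxtimes$ the map $1_\emptyset\mapsto 1_\emptyset\otimes 1_\emptyset$ (zero elsewhere), $\nu:\mathbf I_\boxtimes\to\mathbf I_\otimes$ the inclusion, and $$\mathrm{sh}:(\mathbf V'\otimes\mathbf W')\boxtimes(\mathbf V''\otimes\mathbf W'')\to(\mathbf V'\boxtimes\mathbf V'')\otimes(\mathbf W'\boxtimes\mathbf W'')$$ the inclusion of the summands $\mathbf V'_{\underline x'}\otimes\mathbf W'_{\underline x'}\otimes\mathbf V''_{\underline x''}\otimes\mathbf W''_{\underline x''}\cong(\mathbf V'_{\underline x'}\otimes\mathbf V''_{\underline x''})\otimes(\mathbf W'_{\underline x'}\otimes\mathbf W''_{\underline x''})$. A *commutative 2-algebra bundle* is a vector bundle $\mathbf A$ on $\mathrm{UConf}(M)$ with bundle maps $m_\otimes:\mathbf A\otimes\mathbf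 A\to\mathbf A$, $u_\otimes:\mathbf I_\otimes\to\mathbf A$, $m_\boxtimes:\mathbf A\boxtimes\mathbf A\to\mathbf A$, $u_\boxtimes:\mathbf I_\boxtimes\to\mathbf A$ such that $(\mathbf A,m_\otimes,u_\otimes)$ and $(\mathbf A,m_\boxtimes,u_\boxtimes)$ are commutative monoids for $\otimes$ and $\boxtimes$ (with respect to the braidings that exchange the factors) and $$m_\otimes\circ(m_\boxtimes\otimes m_\boxtimes)\circ\mathrm{sh}=m_\boxtimes\circ(m_\otimes\boxtimes m_\otimes),\quad m_\boxtimes\circ(u_\otimes\boxtimes u_\otimes)=u_\otimes\circ\mu,\quad m_\otimes\circ(u_\boxtimes\otimes u_\boxtimes)\circ\Delta=u_\boxtimes,\quad u_\otimes\circ\nu=u_\boxtimes.$$ For a vector bundle $W$ on $M$, the Cauchy tensor bundle $\mathbf T^\boxtimes(W)$ on $\mathrm{UConf}(M)$ has the fibre over $\underline x$ equal to $\bigoplus W_{x_1}\otimes\cdots\otimes W_{x_k}$, the sum being over all orderings $(x_1,\dots,x_k)$ of $\underline x$. The Cauchy symmetric bundle $\mathbf S^\boxtimes(W)$ is its fibrewise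 quotient by the actions of the groups $S_k$ permuting the tensor factors, with the quotient smooth structure. The class of $w_1\otimes\cdots\otimes w_k$ with $w_i\in W_{x_i}$ is written $w_1\boxdot\cdots\boxdot w_k$. For a vector bundle $V$ on $M$, let $S^\otimes(V)$ be the usual symmetric bundle, with fibres the symmetric algebras $S(V_x)$ and product $\odot$. The *Cauchy-Hadamard bundle* of $V$ is $\mathbf S^\boxtimes S^\otimes(V)$. **Theorem.** For every vector bundle $V$ on $M$, the families $\mathbf A=\mathbf S^\boxtimes S^\otimes(V)$, $\mathbf A\otimes\mathbf A$ and $\mathbf A\boxtimes\mathbf A$ are vector bundles on $\mathrm{UConf}(M)$, and $\mathbf A$ is a commutative 2-algebra bundle with the following operations: - the $\boxtimes$-multiplication is the product induced by concatenation of tensors: $(a_1\boxdot\cdots\boxdot a_i)\otimes(b_1\boxdot\cdots\boxdot b_j)\mapsto a_1\boxdot\cdots\boxdot a_i\boxdot b_1\boxdot\cdots\boxdot b_j$ on the summand of each split $\underline x=\underline x'\sqcup\underline x''$; - the $\boxtimes$-unit sends $1_\emptyset$ to the class of the empty tensor in $\mathbf A_\emptyset$; - the $\otimes$-multiplication is given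 over $\underline x=\{x_1,\dots,x_k\}$ by $(a_1\boxdot\cdots\boxdot a_k)\odot(b_1\boxdot\cdots\boxdot b_k)=(a_1\odot b_1)\boxdot\cdots\boxdot(a_k\odot b_k)$ for $a_i,b_i\in S(V_{x_i})$; - the $\otimes$-unit sends $1_{\underline x}$ to $1_{x_1}\boxdot\cdots\boxdot 1_{x_k}$, where $1_{x_i}\in S(V_{x_i})$ (and $1_\emptyset$ to the class of the empty tensor). -/

import Mathlib

open scoped Manifold ContDiff TensorProduct Topology DirectSum

noncomputable section

namespace ConfBundle

universe u v w w'

/-! ### Families of vector spaces, smooth sections and smooth vector bundles -/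

/-- A family of `𝕂`-vector spaces over `X` together with a notion of smooth section:
`SmoothAt s x` says that the section `s` is smooth on a neighbourhood of `x`.
Local sections are represented by globally defined, set-theoretic ones; only the germ matters. -/
structure Family (𝕂 : Type v) [Field 𝕂] (X : Type u) where
  /-- the fibre over a point -/
  Fib : X → Type w
  [addCommGroup : ∀ x, AddCommGroup (Fib x)]
  [module : ∀ x, Module 𝕂 (Fib x)]
  /-- the section is smooth near the point -/
  SmoothAt : (∀ x, Fib x) → X → Prop

attribute [instance] Family.addCommGroup Family.module

/-- The (set-theoretic) sections of a family. -/
abbrev Family.Section {𝕂 : Type v} [Field 𝕂] {X : Type u} (E : Family.{u, v, w} 𝕂 X) :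
    Type (max u w) := ∀ x, E.Fib x

/-- Near `x`, the section `s` is a finite combination `∑ fⱼ gⱼ` of sections `gⱼ` taken from `G`,
with coefficients `fⱼ` that are smooth near `x`. Here `O f x` means that the scalar function `f`
is smooth near `x`. -/
def GeneratedAt {𝕂 : Type v} [Field 𝕂] {X : Type u} [TopologicalSpace X]
    (O : (X → 𝕂) → X → Prop) {F : X → Type w} [∀ x, AddCommGroup (F x)] [∀ x, Module 𝕂 (F x)]
    (G : Set (∀ x, F x)) (s : ∀ x, F x) (x : X) : Prop :=
  ∃ (n : ℕ) (f : Fin n → X → 𝕂) (g : Fin n → ∀ y, F y),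
    (∀ j, O (f j) x) ∧ (∀ j, g j ∈ G) ∧ ∀ᶠ y in 𝓝 x, s y = ∑ j, f j y • g j y

/-- A family is a smooth vector bundle if it is locally trivial: near every point there is a local
frame `(eᵢ)`, that is, the `eᵢ y` form a basis of the fibre over `y`, and a section is smooth
exactly if it is locally a finite combination of the `eᵢ` with smooth coefficients. For a finite
index set these are the usual smooth vector bundles of finite rank. For an infinite
index set the typical fibre is the colimit `𝕂^(ι)` of its finite-dimensional coordinate subspaces
(ind-finite vector bundles). The rank may vary from one component of `X` to another. -/
def IsVectorBundle {𝕂 : Type v} [Field 𝕂] {X : Type u} [TopologicalSpace X]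
    (O : (X → 𝕂) → X → Prop) (E : Family.{u, v, w} 𝕂 X) : Prop :=
  ∀ x : X, ∃ (ι : Type w) (e : ι → E.Section), ∀ᶠ y in 𝓝 x,
    LinearIndependent 𝕂 (fun i => e i y) ∧
    Submodule.span 𝕂 (Set.range fun i => e i y) = ⊤ ∧
    ∀ s : E.Section, E.SmoothAt s y ↔ GeneratedAt O (Set.range e) s y

/-- A bundle map over the identity: fibrewise linear, and smooth in the sense that it maps smooth
sections to smooth sections. -/
structure BundleMap {𝕂 : Type v} [Field 𝕂] {X : Type u}
    (E : Family.{u, v, w} 𝕂 X) (F : Family.{u, v, w'} 𝕂 X) where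
  toFun : ∀ x, E.Fib x →ₗ[𝕂] F.Fib x
  smooth : ∀ (s : E.Section) (x : X), E.SmoothAt s x → F.SmoothAt (fun y => toFun y (s y)) x

/-- The usual (Hadamard) tensor product `V ⊗ W`, with fibres `V_x ⊗ W_x`; its smooth sections are
locally generated by the `a ⊗ b` with `a`, `b` smooth. -/
abbrev hadamard {𝕂 : Type v} [Field 𝕂] {X : Type u} [TopologicalSpace X] (O : (X → 𝕂) → X → Prop)
    (V : Family.{u, v, w} 𝕂 X) (W : Family.{u, v, w'} 𝕂 X) : Family 𝕂 X where
  Fib x := V.Fib x ⊗[𝕂] W.Fib x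
  SmoothAt s x := GeneratedAt O
    {g | ∃ (a : V.Section) (b : W.Section), V.SmoothAt a x ∧ W.SmoothAt b x ∧
      g = fun y => a y ⊗ₜ[𝕂] b y} s x

/-- The usual symmetric bundle `S^⊗(V)`, with fibres the symmetric algebras `S(V_x)`; its smooth
sections are locally generated by the products `a₁ ⊙ ⋯ ⊙ aₙ` of smooth sections of `V`. -/
abbrev symBundle {𝕂 : Type v} [Field 𝕂] {X : Type u} [TopologicalSpace X] (O : (X → 𝕂) → X → Prop)
    (V : Family.{u, v, w} 𝕂 X) : Family 𝕂 X where
  Fib x := SymmetricAlgebra 𝕂 (V.Fib x)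
  SmoothAt s x := GeneratedAt O
    {g | ∃ l : List V.Section, (∀ a ∈ l, V.SmoothAt a x) ∧
      g = fun y => (l.map fun a => SymmetricAlgebra.ι 𝕂 (V.Fib y) (a y)).prod} s x

section Configurations

open scoped Classical

/-! ### The configuration space -/

/-- The set of configurations, i.e. of finite subsets, of `M`. -/
abbrev UConf (M : Type u) : Type u := Finset M

/-- The ordered configurations of `k` points: injective `k`-tuples. -/
abbrev OConf (k : ℕ) (M : Type u) : Type u := {v : Fin k → M // Function.Injective v}

/-- The map `q_k`, which sends `(x₁, …, x_k)` to `{x₁, …, x_k}`. It is relevant on `OConf k M`, an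
open subset of `M^k`. -/
def q {M : Type u} {k : ℕ} (v : Fin k → M) : UConf M := Finset.univ.image v

/-- `UConf M` is the disjoint union over `k` of the quotient spaces
`UConf_k(M) = OConf_k(M) / S_k`. -/
instance instTopologicalSpaceUConf {M : Type u} [TopologicalSpace M] :
    TopologicalSpace (UConf M) :=
  TopologicalSpace.coinduced (fun p : Σ k, OConf k M => q p.2.1) inferInstance

/-- The ordered splits `c = c' ⊔ c''` of a configuration. -/
structure Split {M : Type u} (c : UConf M) where
  fst : UConf M
  snd : UConf M
  disj : Disjoint fst snd
  union : fst ∪ snd = c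

/-- The labellings (orderings) `(x₁, …, x_k)` of a configuration `c`, i.e. its preimages under the maps `q_k`
(necessarily `k = |c|`). -/
structure Labelling {M : Type u} (c : UConf M) where
  card : ℕ
  pt : Fin card → M
  inj : Function.Injective pt
  eq : q pt = c

/-- The permuted ordering `(x_{σ(1)}, …, x_{σ(k)})`. -/
def Labelling.perm {M : Type u} {c : UConf M} (p : Labelling c) (σ : Equiv.Perm (Fin p.card)) :
    Labelling c where
  card := p.card
  pt := p.pt ∘ σ
  inj := p.inj.comp σ.injective
  eq := by
    refine Eq.trans ?_ p.eq
    ext x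
    simp only [q, Finset.mem_image, Finset.mem_univ, true_and, Function.comp_apply]
    exact ⟨fun ⟨i, h⟩ => ⟨σ i, h⟩, fun ⟨i, h⟩ => ⟨σ.symm i, by simpa using h⟩⟩

/-- The concatenation of orderings of the two parts of a split. -/
def Labelling.append {M : Type u} {c : UConf M} (s : Split c) (p : Labelling s.fst)
    (r : Labelling s.snd) : Labelling c where
  card := p.card + r.card
  pt := Fin.append p.pt r.pt
  inj := by
    refine Fin.append_injective_iff.2 ⟨p.inj, r.inj, fun i j hij => ?_⟩
    have h1 : p.pt i ∈ s.fst :=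
      p.eq.subset (Finset.mem_image_of_mem p.pt (Finset.mem_univ i))
    have h2 : r.pt j ∈ s.snd :=
      r.eq.subset (Finset.mem_image_of_mem r.pt (Finset.mem_univ j))
    exact Finset.disjoint_left.1 s.disj h1 (hij ▸ h2)
  eq := by
    refine Eq.trans (Eq.trans ?_ (congrArg₂ (· ∪ ·) p.eq r.eq)) s.union
    ext x
    simp only [q, Finset.mem_image, Finset.mem_univ, true_and, Finset.mem_union]
    constructor
    · rintro ⟨i, rfl⟩
      refine Fin.addCases (fun j => Or.inl ⟨j, ?_⟩) (fun j => Or.inr ⟨j, ?_⟩) i <;> simp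
    · rintro (⟨j, rfl⟩ | ⟨j, rfl⟩)
      · exact ⟨Fin.castAdd _ j, by simp⟩
      · exact ⟨Fin.natAdd _ j, by simp⟩

variable {𝕂 : Type v} [RCLike 𝕂] {M : Type u} [TopologicalSpace M]

/-- The function `f : M → 𝕂` is smooth on a neighbourhood of `x`. -/
def smoothFun (d : ℕ) [ChartedSpace (EuclideanSpace ℝ (Fin d)) M] (f : M → 𝕂) (x : M) : Prop :=
  ∀ᶠ y in 𝓝 x, ContMDiffAt (𝓡 d) 𝓘(ℝ, 𝕂) ∞ f y

/-- The function `f : UConf M → 𝕂` is smooth on a neighbourhood of `c`, for the quotient manifold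
structure of the `OConf_k(M) / S_k`, for which the maps `q_k` are local diffeomorphisms: the
functions `f ∘ q_k` are smooth, on the open subset `OConf_k(M)` of the product manifold `M^k`,
near the ordered configurations over `c`. -/
def smoothConf (d : ℕ) [ChartedSpace (EuclideanSpace ℝ (Fin d)) M] (f : UConf M → 𝕂)
    (c : UConf M) : Prop :=
  ∀ (k : ℕ) (v : Fin k → M), Function.Injective v → q v = c →
    ∀ᶠ z in 𝓝 v, ContMDiffAt (ModelWithCorners.pi fun _ : Fin k => 𝓡 d) 𝓘(ℝ, 𝕂) ∞
      (fun t : Fin k → M => f (q t)) z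

/-! ### The Cauchy tensor product and the 2-monoidal structure -/

/-- The underlying fibres `⨁_{c = c' ⊔ c''} V_{c'} ⊗ W_{c''}` of the Cauchy tensor product. -/
abbrev CauchyFib (V : Family.{u, v, w} 𝕂 (UConf M)) (W : Family.{u, v, w'} 𝕂 (UConf M))
    (c : UConf M) : Type (max u w w') :=
  ⨁ p : Split c, V.Fib p.fst ⊗[𝕂] W.Fib p.snd

/-- The inclusion of the summand `V_{c'} ⊗ W_{c''}` into `(V ⊠ W)_c`. -/
def inc (V : Family.{u, v, w} 𝕂 (UConf M)) (W : Family.{u, v, w'} 𝕂 (UConf M)) {c : UConf M}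
    (p : Split c) : V.Fib p.fst ⊗[𝕂] W.Fib p.snd →ₗ[𝕂] CauchyFib V W c :=
  DirectSum.lof 𝕂 (Split c) (fun p => V.Fib p.fst ⊗[𝕂] W.Fib p.snd) p

variable (d : ℕ) [ChartedSpace (EuclideanSpace ℝ (Fin d)) M]

/-- The Cauchy tensor product `V ⊠ W`. Its smooth sections near `c` are generated by the following
ones, where `c = c₁ ⊔ c₂` is a split of `c`, and `a`, `b` are smooth sections of `V`, `W` near
`c₁`, `c₂`: a configuration near `c` is `d₁ ⊔ d₂` for unique `d₁`, `d₂` near `c₁`, `c₂`, and the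
value of the section there is `a(d₁) ⊗ b(d₂)`, in the summand of that split. After the pullback to
`OConf_k(M)` this is the direct sum of external tensor products. -/
abbrev cauchy (V : Family.{u, v, w} 𝕂 (UConf M)) (W : Family.{u, v, w'} 𝕂 (UConf M)) :
    Family.{u, v, max u w w'} 𝕂 (UConf M) where
  Fib c := CauchyFib V W c
  SmoothAt s c := GeneratedAt (smoothConf (𝕂 := 𝕂) d)
    {g | ∃ (p : Split c) (a : V.Section) (b : W.Section),
      V.SmoothAt a p.fst ∧ W.SmoothAt b p.snd ∧
      ∀ᶠ r : UConf M × UConf M in 𝓝 (p.fst, p.snd), ∀ h : Disjoint r.1 r.2,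
        g (r.1 ∪ r.2) = inc V W ⟨r.1, r.2, h, rfl⟩ (a r.1 ⊗ₜ[𝕂] b r.2)} s c

/-- The unit `I_⊗` of the Hadamard tensor product: the trivial line bundle. -/
abbrev unitH : Family.{u, v, v} 𝕂 (UConf M) where
  Fib _ := 𝕂
  SmoothAt (s : UConf M → 𝕂) c := smoothConf d s c

/-- The fibres of `I_⊠`: `𝕂` over the empty configuration and zero over all the others, as
subspaces of the fibre `𝕂` of the trivial line bundle. -/
def unitCFib (𝕂 : Type v) [RCLike 𝕂] (c : UConf M) : Submodule 𝕂 𝕂 := if c = ∅ then ⊤ else ⊥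

/-- The unit `I_⊠` of the Cauchy tensor product, as a subbundle of the trivial line bundle. -/
abbrev unitC : Family.{u, v, v} 𝕂 (UConf M) where
  Fib c := unitCFib 𝕂 c
  SmoothAt s c := smoothConf d (fun c' => (s c' : 𝕂)) c

/-- The generator `1_∅` of `I_⊠` over the empty configuration (and zero elsewhere). -/
def oneC (𝕂 : Type v) [RCLike 𝕂] (c : UConf M) : unitCFib 𝕂 c :=
  if h : c = ∅ then ⟨1, by simp [unitCFib, h]⟩ else 0

/-- The inclusion `ν : I_⊠ → I_⊗`. -/
def nu (c : UConf M) : (unitC (𝕂 := 𝕂) (M := M) d).Fib c →ₗ[𝕂] (unitH (𝕂 := 𝕂) (M := M) d).Fib c :=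
  (unitCFib 𝕂 c).subtype

/-- The map `Δ : I_⊠ → I_⊠ ⊗ I_⊠`, which sends `1_∅` to `1_∅ ⊗ 1_∅` over the empty configuration
and vanishes elsewhere. -/
def delta (c : UConf M) : (unitC (𝕂 := 𝕂) (M := M) d).Fib c →ₗ[𝕂]
    (unitC (𝕂 := 𝕂) (M := M) d).Fib c ⊗[𝕂] (unitC (𝕂 := 𝕂) (M := M) d).Fib c :=
  LinearMap.toSpanSingleton 𝕂 _ (oneC 𝕂 c ⊗ₜ[𝕂] oneC 𝕂 c) ∘ₗ nu d c

/-- The map `μ : I_⊗ ⊠ I_⊗ → I_⊗`, the multiplication of scalars on each summand. -/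
def mu (c : UConf M) : (cauchy d (unitH (𝕂 := 𝕂) (M := M) d) (unitH d)).Fib c →ₗ[𝕂]
    (unitH (𝕂 := 𝕂) (M := M) d).Fib c :=
  DirectSum.toModule 𝕂 _ _ fun _ => LinearMap.mul' 𝕂 𝕂

section

universe w₁ w₂ w₃ w₄

variable (V : Family.{u, v, w₁} 𝕂 (UConf M)) (W : Family.{u, v, w₂} 𝕂 (UConf M))
  (V' : Family.{u, v, w₃} 𝕂 (UConf M)) (W' : Family.{u, v, w₄} 𝕂 (UConf M))

variable {V W V' W'} in
/-- The fibrewise map `f ⊠ g`. -/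
def cauchyMap (f : ∀ c, V.Fib c →ₗ[𝕂] V'.Fib c) (g : ∀ c, W.Fib c →ₗ[𝕂] W'.Fib c) (c : UConf M) :
    (cauchy d V W).Fib c →ₗ[𝕂] (cauchy d V' W').Fib c :=
  DirectSum.toModule 𝕂 _ _ fun p => inc V' W' p ∘ₗ TensorProduct.map (f p.fst) (g p.snd)

/-- The braiding `τ_⊠ : V ⊠ W → W ⊠ V`. -/
def braidC (c : UConf M) : (cauchy d V W).Fib c →ₗ[𝕂] (cauchy d W V).Fib c :=
  DirectSum.toModule 𝕂 _ _ fun p =>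
    inc W V ⟨p.snd, p.fst, p.disj.symm, (Finset.union_comm _ _).trans p.union⟩ ∘ₗ
      (TensorProduct.comm 𝕂 (V.Fib p.fst) (W.Fib p.snd)).toLinearMap

/-- The associativity isomorphism `(V ⊠ W) ⊠ V' → V ⊠ (W ⊠ V')`: on the summand of
`c = (c₁ ⊔ c₂) ⊔ c₃` it is `(a ⊗ b) ⊗ e ↦ a ⊗ (b ⊗ e)`. -/
def assocC (c : UConf M) : (cauchy d (cauchy d V W) V').Fib c →ₗ[𝕂]
    (cauchy d V (cauchy d W V')).Fib c :=
  DirectSum.toModule 𝕂 _ _ fun p => TensorProduct.lift <|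
    DirectSum.toModule 𝕂 (Split p.fst) _ fun r =>
      have h : Disjoint r.fst p.snd ∧ Disjoint r.snd p.snd :=
        Finset.disjoint_union_left.1 (by rw [r.union]; exact p.disj)
      let p' : Split (r.snd ∪ p.snd) := ⟨r.snd, p.snd, h.2, rfl⟩
      let p'' : Split c := ⟨r.fst, r.snd ∪ p.snd, Finset.disjoint_union_right.2 ⟨r.disj, h.1⟩,
        by rw [← Finset.union_assoc, r.union, p.union]⟩
      TensorProduct.curry <| inc V (cauchy d W V') p'' ∘ₗ
        TensorProduct.map LinearMap.id (inc W V' p') ∘ₗ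
        (TensorProduct.assoc 𝕂 (V.Fib r.fst) (W.Fib r.snd) (V'.Fib p.snd)).toLinearMap

/-- The inverse `V → I_⊠ ⊠ V`, `a ↦ 1_∅ ⊗ a`, of the left unit isomorphism. -/
def leftUnitC (c : UConf M) : V.Fib c →ₗ[𝕂] (cauchy d (unitC d) V).Fib c :=
  inc (unitC d) V ⟨∅, c, Finset.disjoint_empty_left c, Finset.empty_union c⟩ ∘ₗ
    TensorProduct.mk 𝕂 (unitCFib 𝕂 ∅) (V.Fib c) (oneC 𝕂 ∅)

/-- The inverse `V → V ⊠ I_⊠`, `a ↦ a ⊗ 1_∅`, of the right unit isomorphism. -/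
def rightUnitC (c : UConf M) : V.Fib c →ₗ[𝕂] (cauchy d V (unitC d)).Fib c :=
  inc V (unitC d) ⟨c, ∅, Finset.disjoint_empty_right c, Finset.union_empty c⟩ ∘ₗ
    (TensorProduct.mk 𝕂 (V.Fib c) (unitCFib 𝕂 ∅)).flip (oneC 𝕂 ∅)

/-- The shuffle map `sh : (V ⊗ W) ⊠ (V' ⊗ W') → (V ⊠ V') ⊗ (W ⊠ W')`: the inclusion of the summands
where both factors of the target are split in the same way. -/
def shuffle (c : UConf M) :
    (cauchy d (hadamard (smoothConf d) V W) (hadamard (smoothConf d) V' W')).Fib c →ₗ[𝕂]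
      (hadamard (smoothConf d) (cauchy d V V') (cauchy d W W')).Fib c :=
  DirectSum.toModule 𝕂 _ _ fun p =>
    TensorProduct.map (inc V V' p) (inc W W' p) ∘ₗ
      (TensorProduct.tensorTensorTensorComm 𝕂 (V.Fib p.fst) (W.Fib p.fst) (V'.Fib p.snd)
        (W'.Fib p.snd)).toLinearMap

end

/-! ### 2-algebra bundles -/

/-- The structure of a 2-algebra bundle (double monoid) on the vector bundle `A`: a monoid structure
for `⊗` and one for `⊠`, which are compatible through `sh`, `μ`, `Δ` and `ν`. -/
structure TwoAlgebra (A : Family.{u, v, w} 𝕂 (UConf M)) where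
  isVectorBundle : IsVectorBundle (smoothConf d) A
  /-- the `⊗`-multiplication -/
  mulH : BundleMap (hadamard (smoothConf d) A A) A
  /-- the `⊗`-unit -/
  oneH : BundleMap (unitH (𝕂 := 𝕂) (M := M) d) A
  /-- the `⊠`-multiplication -/
  mulC : BundleMap (cauchy d A A) A
  /-- the `⊠`-unit -/
  unC : BundleMap (unitC (𝕂 := 𝕂) (M := M) d) A
  mulH_assoc : ∀ c, mulH.toFun c ∘ₗ TensorProduct.map (mulH.toFun c) LinearMap.id =
    mulH.toFun c ∘ₗ TensorProduct.map LinearMap.id (mulH.toFun c) ∘ₗ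
      (TensorProduct.assoc 𝕂 (A.Fib c) (A.Fib c) (A.Fib c)).toLinearMap
  oneH_mulH : ∀ c, mulH.toFun c ∘ₗ TensorProduct.map (oneH.toFun c) LinearMap.id =
    (TensorProduct.lid 𝕂 (A.Fib c)).toLinearMap
  mulH_oneH : ∀ c, mulH.toFun c ∘ₗ TensorProduct.map LinearMap.id (oneH.toFun c) =
    (TensorProduct.rid 𝕂 (A.Fib c)).toLinearMap
  mulC_assoc : ∀ c, mulC.toFun c ∘ₗ cauchyMap d mulC.toFun (fun _ => LinearMap.id) c =
    mulC.toFun c ∘ₗ cauchyMap d (fun _ => LinearMap.id) mulC.toFun c ∘ₗ assocC d A A A c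
  unC_mulC : ∀ c, mulC.toFun c ∘ₗ cauchyMap d unC.toFun (fun _ => LinearMap.id) c ∘ₗ
    leftUnitC d A c = LinearMap.id
  mulC_unC : ∀ c, mulC.toFun c ∘ₗ cauchyMap d (fun _ => LinearMap.id) unC.toFun c ∘ₗ
    rightUnitC d A c = LinearMap.id
  /-- `m_⊗ ∘ (m_⊠ ⊗ m_⊠) ∘ sh = m_⊠ ∘ (m_⊗ ⊠ m_⊗)` -/
  interchange : ∀ c, mulH.toFun c ∘ₗ TensorProduct.map (mulC.toFun c) (mulC.toFun c) ∘ₗ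
    shuffle d A A A A c = mulC.toFun c ∘ₗ cauchyMap d mulH.toFun mulH.toFun c
  /-- `m_⊠ ∘ (u_⊗ ⊠ u_⊗) = u_⊗ ∘ μ` -/
  mulC_oneH : ∀ c, mulC.toFun c ∘ₗ cauchyMap d oneH.toFun oneH.toFun c = oneH.toFun c ∘ₗ mu d c
  /-- `m_⊗ ∘ (u_⊠ ⊗ u_⊠) ∘ Δ = u_⊠` -/
  mulH_unC : ∀ c, mulH.toFun c ∘ₗ TensorProduct.map (unC.toFun c) (unC.toFun c) ∘ₗ delta d c =
    unC.toFun c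
  /-- `u_⊗ ∘ ν = u_⊠` -/
  oneH_nu : ∀ c, oneH.toFun c ∘ₗ nu d c = unC.toFun c

/-- A 2-algebra bundle is commutative if both multiplications are. -/
def TwoAlgebra.IsCommutative {d : ℕ} [ChartedSpace (EuclideanSpace ℝ (Fin d)) M]
    {A : Family.{u, v, w} 𝕂 (UConf M)} (T : TwoAlgebra d A) : Prop :=
  (∀ c, T.mulH.toFun c ∘ₗ (TensorProduct.comm 𝕂 (A.Fib c) (A.Fib c)).toLinearMap =
    T.mulH.toFun c) ∧
  ∀ c, T.mulC.toFun c ∘ₗ braidC d A A c = T.mulC.toFun c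

/-! ### The Cauchy symmetric bundle -/

variable (V : Family.{u, v, w} 𝕂 M)

/-- The fibre `⨁ V_{x₁} ⊗ ⋯ ⊗ V_{x_k}` of the Cauchy tensor bundle `T^⊠(V)` over `c`: the sum is
over all orderings `(x₁, …, x_k)` of `c`. -/
abbrev TensorFib (c : UConf M) : Type (max u v w) :=
  ⨁ p : Labelling c, ⨂[𝕂] i : Fin p.card, V.Fib (p.pt i)

/-- The tensor `a_{x₁} ⊗ ⋯ ⊗ a_{x_k}` in `T^⊠(V)_c`, where `(x₁, …, x_k)` is an ordering of `c`.
Since the `xᵢ` are distinct, every decomposable tensor has this form. -/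
def tens (a : V.Section) {c : UConf M} (p : Labelling c) : TensorFib V c :=
  DirectSum.lof 𝕂 (Labelling c) (fun p => ⨂[𝕂] i : Fin p.card, V.Fib (p.pt i)) p
    (PiTensorProduct.tprod 𝕂 fun i => a (p.pt i))

/-- The Cauchy tensor bundle `T^⊠(V)`. Its smooth sections near `c` are generated by the sections
`(y₁, …, y_k) ↦ a(y₁) ⊗ ⋯ ⊗ a(y_k)`, where `(y₁, …, y_k)` is near a fixed ordering
`(x₁, …, x_k)` of `c` and where `a` is a section of `V` that is smooth near each `xᵢ` (as the `xᵢ`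
are distinct this amounts to smooth local sections `aᵢ` near the `xᵢ`). -/
abbrev cauchyTensor : Family.{u, v, max u v w} 𝕂 (UConf M) where
  Fib c := TensorFib V c
  SmoothAt s c := GeneratedAt (smoothConf (𝕂 := 𝕂) d)
    {g | ∃ (p : Labelling c) (a : V.Section), (∀ i, V.SmoothAt a (p.pt i)) ∧
      ∀ᶠ y in 𝓝 p.pt, ∀ h : Function.Injective y, g (q y) = tens V a ⟨p.card, y, h, rfl⟩} s c

/-- The subspace spanned by the differences `v - σ(v)`, for decomposable `v` and `σ ∈ S_k`, where
`σ (v₁ ⊗ ⋯ ⊗ v_k) = v_{σ(1)} ⊗ ⋯ ⊗ v_{σ(k)}`. -/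
def symRel (c : UConf M) : Submodule 𝕂 (TensorFib V c) :=
  Submodule.span 𝕂 {t | ∃ (a : V.Section) (p : Labelling c) (σ : Equiv.Perm (Fin p.card)),
    t = tens V a p - tens V a (p.perm σ)}

/-- The Cauchy symmetric bundle `S^⊠(V)`: the fibrewise quotient of `T^⊠(V)` by the actions of the
symmetric groups. A section is smooth if it lifts locally to a smooth section of `T^⊠(V)`. -/
abbrev cauchySym : Family.{u, v, max u v w} 𝕂 (UConf M) where
  Fib c := TensorFib V c ⧸ symRel V c
  SmoothAt s c := ∃ t : (cauchyTensor d V).Section, (cauchyTensor d V).SmoothAt t c ∧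
    ∀ᶠ c' in 𝓝 c, s c' = (symRel V c').mkQ (t c')

/-- The class `a_{x₁} ⊡ ⋯ ⊡ a_{x_k}` of `a_{x₁} ⊗ ⋯ ⊗ a_{x_k}` in `S^⊠(V)_c`, for an ordering
`(x₁, …, x_k)` of `c`. -/
def boxdot (a : V.Section) {c : UConf M} (p : Labelling c) : (cauchySym d V).Fib c :=
  (symRel V c).mkQ (tens V a p)

/-- The Cauchy-Hadamard bundle `S^⊠ S^⊗(V)` of a vector bundle `V` on `M`. -/
abbrev cauchyHadamard : Family.{u, v, max u v w} 𝕂 (UConf M) :=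
  cauchySym d (symBundle (smoothFun d) V)

end Configurations

end ConfBundle

end

open ConfBundle

/-! Over a configuration `c`, the quotient of the sum over all orderings by the symmetric groups is
the unordered tensor product `⨂_{x ∈ c} E_x` (`fibEquiv`). A section `a` of `E` therefore yields a
section `c ↦ ⊡_{x ∈ c} a(x)` of `S^⊠(E)`, written `boxdotSection`. Its values span every fibre, and
those with `a` smooth near the points of `c` generate the smooth germs at `c`
(`cauchySym_smoothAt_iff`).

In these terms, with `E = S^⊗(V)`, the operations are determined by three rules. The product `⊠`
sends the values of `a` on the two parts of a split to its value on the whole; the product `⊗`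
multiplies sections pointwise; the unit of `⊗` is the section `1`. The unit of `⊠` is then forced by
`u_⊗ ∘ ν = u_⊠`. Since the parts of a split are disjoint, sections can be prescribed independently
on them, so each multilinear identity in a Cauchy product may be tested on one section throughout.
There it reduces to set-theoretic identities between splits or to identities in the commutative
algebras `S(V_x)`. `Presentation` isolates this argument.

Local triviality rests on one topological fact: since `M` is Hausdorff, the points of configurations
near `c` are labelled by those of `c` in a locally constant way (`exists_isLabelling`). Hence the
index sets of the sums over splits and of the tensor products over points do not change near `c`.
Frames of the factors near the points or parts of `c` then combine to a frame
(`isFrameAt_cauchySym`, `isFrameAt_cauchy`), and expanding products by multilinearity shows that it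
generates. The coefficients that arise are finite products of functions over the points of a
configuration, or functions of one part of a split. Both are smooth because, in ordered coordinates,
they are built from coordinate projections. -/

namespace ConfBundle

universe u v w w' w''

/-- The predicate `O` on germs of scalar functions contains the constants, is closed under sums and
products, and depends only on the germ. -/
structure IsGermRing {𝕂 : Type v} [Field 𝕂] {X : Type u} [TopologicalSpace X]
    (O : (X → 𝕂) → X → Prop) : Prop where
  const : ∀ (r : 𝕂) (x : X), O (fun _ => r) x
  add : ∀ {f g : X → 𝕂} {x : X}, O f x → O g x → O (fun y => f y + g y) x
  mul : ∀ {f g : X → 𝕂} {x : X}, O f x → O g x → O (fun y => f y * g y) x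
  congr : ∀ {f g : X → 𝕂} {x : X}, f =ᶠ[𝓝 x] g → O f x → O g x

/-! ### Calculus of locally generated sections -/

section Generated

variable {𝕂 : Type v} [Field 𝕂] {X : Type u} [TopologicalSpace X] {O : (X → 𝕂) → X → Prop}
  {F : X → Type w} [∀ x, AddCommGroup (F x)] [∀ x, Module 𝕂 (F x)]
  {F' : X → Type w'} [∀ x, AddCommGroup (F' x)] [∀ x, Module 𝕂 (F' x)]
  {F'' : X → Type w''} [∀ x, AddCommGroup (F'' x)] [∀ x, Module 𝕂 (F'' x)]

theorem GeneratedAt.of_mem (hO : IsGermRing O) {G : Set (∀ x, F x)} {s : ∀ x, F x} (hs : s ∈ G)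
    (x : X) : GeneratedAt O G s x :=
  ⟨1, fun _ _ => 1, fun _ => s, fun _ => hO.const 1 x, fun _ => hs, by simp⟩

theorem GeneratedAt.congr {G : Set (∀ x, F x)} {s t : ∀ x, F x} {x : X}
    (hs : GeneratedAt O G s x) (h : ∀ᶠ y in 𝓝 x, t y = s y) : GeneratedAt O G t x := by
  obtain ⟨n, f, g, hf, hg, e⟩ := hs
  exact ⟨n, f, g, hf, hg, by filter_upwards [h, e] with y h1 h2 using h1.trans h2⟩

theorem GeneratedAt.mono {G G' : Set (∀ x, F x)} {s : ∀ x, F x} {x : X}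
    (hs : GeneratedAt O G s x) (h : G ⊆ G') : GeneratedAt O G' s x := by
  obtain ⟨n, f, g, hf, hg, e⟩ := hs
  exact ⟨n, f, g, hf, fun j => h (hg j), e⟩

theorem GeneratedAt.zero {G : Set (∀ x, F x)} {x : X} : GeneratedAt O G (fun _ => 0) x :=
  ⟨0, Fin.elim0, Fin.elim0, fun j => j.elim0, fun j => j.elim0, by simp⟩

theorem GeneratedAt.add {G : Set (∀ x, F x)} {s t : ∀ x, F x} {x : X}
    (hs : GeneratedAt O G s x) (ht : GeneratedAt O G t x) :
    GeneratedAt O G (fun y => s y + t y) x := by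
  obtain ⟨n, f, g, hf, hg, e⟩ := hs
  obtain ⟨n', f', g', hf', hg', e'⟩ := ht
  refine ⟨n + n', Fin.append f f', Fin.append g g', fun j => ?_, fun j => ?_, ?_⟩
  · refine Fin.addCases (fun i => ?_) (fun i => ?_) j
    · simpa using hf i
    · simpa using hf' i
  · refine Fin.addCases (fun i => ?_) (fun i => ?_) j
    · simpa using hg i
    · simpa using hg' i
  · filter_upwards [e, e'] with y h h'
    simp [Fin.sum_univ_add, h, h']

theorem GeneratedAt.sum {G : Set (∀ x, F x)} {ι : Type*} (t : Finset ι) {s : ι → ∀ x, F x} {x : X}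
    (hs : ∀ i ∈ t, GeneratedAt O G (s i) x) : GeneratedAt O G (fun y => ∑ i ∈ t, s i y) x := by
  classical
  induction t using Finset.induction_on with
  | empty => simpa using GeneratedAt.zero
  | insert i t hi ih =>
    simp only [Finset.sum_insert hi]
    exact (hs i (by simp)).add (ih fun j hj => hs j (by simp [hj]))

theorem GeneratedAt.smul (hO : IsGermRing O) {G : Set (∀ x, F x)} {s : ∀ x, F x} {x : X}
    {f : X → 𝕂} (hf : O f x) (hs : GeneratedAt O G s x) :
    GeneratedAt O G (fun y => f y • s y) x := by
  obtain ⟨n, f', g, hf', hg, e⟩ := hs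
  refine ⟨n, fun j y => f y * f' j y, g, fun j => hO.mul hf (hf' j), hg, ?_⟩
  filter_upwards [e] with y h
  simp [h, Finset.smul_sum, mul_smul]

/-- Fibrewise linearity lets `φ` pass through the finite combination, so only generators matter. No
smooth dependence of `φ` on the point is assumed; hence one argument of a bilinear map can be frozen
at an arbitrary section, which gives `GeneratedAt.map₂`. -/
theorem GeneratedAt.map (hO : IsGermRing O) {G : Set (∀ x, F x)} {G' : Set (∀ x, F' x)}
    {s : ∀ x, F x} {x : X} (hs : GeneratedAt O G s x) (φ : ∀ x, F x →ₗ[𝕂] F' x)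
    (h : ∀ g ∈ G, GeneratedAt O G' (fun y => φ y (g y)) x) :
    GeneratedAt O G' (fun y => φ y (s y)) x := by
  obtain ⟨n, f, g, hf, hg, e⟩ := hs
  refine (GeneratedAt.sum (s := fun j y => f j y • φ y (g j y)) Finset.univ
    fun j _ => (h _ (hg j)).smul hO (hf j)).congr ?_
  filter_upwards [e] with y h
  simp [h]

theorem GeneratedAt.trans (hO : IsGermRing O) {G G' : Set (∀ x, F x)} {s : ∀ x, F x} {x : X}
    (hs : GeneratedAt O G s x) (h : ∀ g ∈ G, GeneratedAt O G' g x) : GeneratedAt O G' s x :=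
  hs.map hO (fun _ => LinearMap.id) h

theorem GeneratedAt.map₂ (hO : IsGermRing O) {G : Set (∀ x, F x)} {G' : Set (∀ x, F' x)}
    {G'' : Set (∀ x, F'' x)} {s : ∀ x, F x} {t : ∀ x, F' x} {x : X} (hs : GeneratedAt O G s x)
    (ht : GeneratedAt O G' t x) (B : ∀ x, F x →ₗ[𝕂] F' x →ₗ[𝕂] F'' x)
    (h : ∀ g ∈ G, ∀ g' ∈ G', GeneratedAt O G'' (fun y => B y (g y) (g' y)) x) :
    GeneratedAt O G'' (fun y => B y (s y) (t y)) x :=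
  hs.map hO (fun y => (B y).flip (t y)) fun g hg => ht.map hO (fun y => B y (g y)) fun g' hg' =>
    h g hg g' hg'

end Generated

/-! ### Local frames; Hadamard products and symmetric bundles -/

section Frames

variable {𝕂 : Type v} [Field 𝕂] {X : Type u} [TopologicalSpace X] {O : (X → 𝕂) → X → Prop}

/-- The sections `eᵢ` form a frame of `E` at `y`: their values are a basis of the fibre, and they
generate the smooth germs. -/
def IsFrameAt (O : (X → 𝕂) → X → Prop) (E : Family.{u, v, w} 𝕂 X) {ι : Type*}
    (e : ι → E.Section) (y : X) : Prop :=
  LinearIndependent 𝕂 (fun i => e i y) ∧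
    Submodule.span 𝕂 (Set.range fun i => e i y) = ⊤ ∧
    ∀ s : E.Section, E.SmoothAt s y ↔ GeneratedAt O (Set.range e) s y

variable {E : Family.{u, v, w} 𝕂 X} {E' : Family.{u, v, w'} 𝕂 X} {ι : Type*} {ι' : Type*}
  {e : ι → E.Section} {e' : ι' → E'.Section} {y : X}

theorem IsFrameAt.smooth (h : IsFrameAt O E e y) (hO : IsGermRing O) (i : ι) :
    E.SmoothAt (e i) y :=
  (h.2.2 _).2 (.of_mem hO (Set.mem_range_self i) y)

/-- The basis of the fibre given by a frame. -/
noncomputable def IsFrameAt.basis (h : IsFrameAt O E e y) : Module.Basis ι 𝕂 (E.Fib y) :=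
  Module.Basis.mk h.1 h.2.1.ge

@[simp]
theorem IsFrameAt.basis_apply (h : IsFrameAt O E e y) (i : ι) : h.basis i = e i y := by
  simp [IsFrameAt.basis]

theorem IsFrameAt.of_basis (b : Module.Basis ι 𝕂 (E.Fib y)) (hb : ∀ i, b i = e i y)
    (h : ∀ s : E.Section, E.SmoothAt s y ↔ GeneratedAt O (Set.range e) s y) :
    IsFrameAt O E e y := by
  have hb' : (fun i => e i y) = b := funext fun i => (hb i).symm
  refine ⟨?_, ?_, h⟩
  · rw [hb']; exact b.linearIndependent
  · rw [hb']; exact b.span_eq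

/-- In `IsVectorBundle` the universe of the index set of a frame is irrelevant. -/
theorem isVectorBundle_of_frames
    (h : ∀ x : X, ∃ (ι : Type w') (e : ι → E.Section), ∀ᶠ y in 𝓝 x, IsFrameAt O E e y) :
    IsVectorBundle O E := by
  intro x
  obtain ⟨ι, e, he⟩ := h x
  have hx := he.self_of_nhds
  -- The values of the frame at `x` are distinct by linear independence, so they can serve as the
  -- index set, and they lie in the universe of the fibre.
  let σ : Set.range (fun i => e i x) ≃ ι := (Equiv.ofInjective _ hx.1.injective).symm
  refine ⟨Set.range (fun i => e i x), fun j => e (σ j), ?_⟩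
  filter_upwards [he] with y hy
  refine IsFrameAt.of_basis (hy.basis.reindex σ.symm) (by simp) fun s => ?_
  rw [hy.2.2 s]
  have : Set.range (fun j => e (σ j)) = Set.range e := σ.surjective.range_comp e
  rw [this]

/-- A `Family` does not require `SmoothAt` to depend only on the germ. Local triviality supplies
this, because generation by a frame is a condition on germs. -/
theorem IsVectorBundle.smoothAt_congr (hE : IsVectorBundle O E) {s t : E.Section} {x : X}
    (hs : E.SmoothAt s x) (h : ∀ᶠ y in 𝓝 x, t y = s y) : E.SmoothAt t x := by
  obtain ⟨ι, e, he⟩ := hE x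
  have hx := he.self_of_nhds.2.2
  exact (hx t).2 (((hx s).1 hs).congr h)

/-- The two frames may live at different points: the summands of a Cauchy product are tensor
products of fibres over two different configurations. -/
theorem IsFrameAt.exists_basis_tmul {X' : Type*} [TopologicalSpace X'] {O' : (X' → 𝕂) → X' → Prop}
    {E' : Family 𝕂 X'} {e' : ι' → E'.Section} {y' : X'} (h : IsFrameAt O E e y)
    (h' : IsFrameAt O' E' e' y') : ∃ B : Module.Basis (ι × ι') 𝕂 (E.Fib y ⊗[𝕂] E'.Fib y'),
      ∀ j, B j = e j.1 y ⊗ₜ[𝕂] e' j.2 y' :=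
  ⟨h.basis.tensorProduct h'.basis, by simp⟩

theorem IsFrameAt.hadamard (hO : IsGermRing O) (h : IsFrameAt O E e y) (h' : IsFrameAt O E' e' y) :
    IsFrameAt O (hadamard O E E') (fun (p : ι × ι') x => e p.1 x ⊗ₜ[𝕂] e' p.2 x) y := by
  obtain ⟨B, hB⟩ := h.exists_basis_tmul h'
  refine .of_basis B hB fun s => ⟨fun hs => ?_, fun hs => ?_⟩
  · refine GeneratedAt.trans hO hs ?_
    rintro _ ⟨a, b, ha, hb, rfl⟩
    refine ((h.2.2 a).1 ha).map₂ hO ((h'.2.2 b).1 hb) (fun x => TensorProduct.mk 𝕂 _ _) ?_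
    rintro _ ⟨i, rfl⟩ _ ⟨j, rfl⟩
    exact .of_mem hO (Set.mem_range_self (i, j)) _
  · refine hs.mono ?_
    rintro _ ⟨p, rfl⟩
    exact ⟨_, _, h.smooth hO p.1, h'.smooth hO p.2, rfl⟩

theorem IsVectorBundle.hadamard (hO : IsGermRing O) (hE : IsVectorBundle O E)
    (hE' : IsVectorBundle O E') : IsVectorBundle O (hadamard O E E') := by
  refine isVectorBundle_of_frames fun x => ?_
  obtain ⟨ι, e, he⟩ := hE x
  obtain ⟨ι', e', he'⟩ := hE' x
  refine ⟨ι × ι', fun p x => e p.1 x ⊗ₜ[𝕂] e' p.2 x, ?_⟩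
  filter_upwards [he, he'] with y h h' using IsFrameAt.hadamard hO h h'

/-- The monomial sections of the symmetric bundle. -/
noncomputable def symMonomial (e : ι → E.Section) (m : ι →₀ ℕ) : (symBundle O E).Section :=
  fun y => m.prod fun i n => SymmetricAlgebra.ι 𝕂 (E.Fib y) (e i y) ^ n

theorem symMonomial_add (m n : ι →₀ ℕ) : symMonomial (O := O) e (m + n) y =
    symMonomial (O := O) e m y * symMonomial (O := O) e n y := by
  classical
  exact Finsupp.prod_add_index' (by simp) (fun _ _ _ => pow_add _ _ _)

/-- This exhibits a monomial as one of the list products that generate the smooth sections of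
`symBundle`; commutativity makes the arbitrary order of the list harmless. -/
theorem symMonomial_eq_list (m : ι →₀ ℕ) : symMonomial (O := O) e m =
    fun y => (((Finsupp.toMultiset m).toList.map e).map
      fun a => SymmetricAlgebra.ι 𝕂 (E.Fib y) (a y)).prod := by
  classical
  funext y
  induction m using Finsupp.induction_linear with
  | zero => simp [symMonomial]
  | add f g hf hg =>
    rw [symMonomial_add, hf, hg]
    simp only [List.map_map, ← Multiset.prod_coe, ← Multiset.map_coe, Multiset.coe_toList, map_add,
      Multiset.map_add, Multiset.prod_add]
  | single i n =>
    simp only [List.map_map, ← Multiset.prod_coe, ← Multiset.map_coe, Multiset.coe_toList]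
    simp [symMonomial, Multiset.map_nsmul, Multiset.prod_nsmul]

/-- The symmetric algebra of a space with a basis is a polynomial ring, so the monomials in the
frame are a basis. They generate because a product of monomials is a monomial, which allows
induction on the length of a product of sections. -/
theorem IsFrameAt.symBundle (hO : IsGermRing O) (h : IsFrameAt O E e y) :
    IsFrameAt O (symBundle O E) (symMonomial (O := O) e) y := by
  refine .of_basis h.basis.symmetricAlgebra (fun m => ?_) fun s => ⟨fun hs => ?_, fun hs => ?_⟩
  · simp only [Module.Basis.symmetricAlgebra, Module.Basis.map_apply,
      MvPolynomial.coe_basisMonomials, AlgEquiv.toLinearEquiv_apply]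
    rw [MvPolynomial.monomial_eq, map_mul, Finsupp.prod, map_prod]
    simp [symMonomial, Finsupp.prod, -MvPolynomial.prod_X_pow_eq_monomial]
  · refine GeneratedAt.trans hO hs ?_
    rintro _ ⟨l, hl, rfl⟩
    induction l with
    | nil => exact (GeneratedAt.of_mem hO (Set.mem_range_self 0) _).congr (by simp [symMonomial])
    | cons a l ih =>
      simp only [List.map_cons, List.prod_cons]
      have h1 : GeneratedAt O (Set.range (symMonomial (O := O) e))
          (fun x => SymmetricAlgebra.ι 𝕂 (E.Fib x) (a x)) y := by
        refine ((h.2.2 a).1 (hl a (by simp))).map hO (fun x => SymmetricAlgebra.ι 𝕂 (E.Fib x)) ?_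
        rintro _ ⟨i, rfl⟩
        refine (GeneratedAt.of_mem hO (Set.mem_range_self (Finsupp.single i 1)) _).congr
          (.of_forall fun x => ?_)
        simp [symMonomial]
      refine h1.map₂ hO (ih fun b hb => hl b (by simp [hb])) (fun x => LinearMap.mul 𝕂 _) ?_
      rintro _ ⟨m, rfl⟩ _ ⟨n, rfl⟩
      exact (GeneratedAt.of_mem hO (Set.mem_range_self (m + n)) _).congr
        (.of_forall fun x => by simp [symMonomial_add])
  · refine hs.mono ?_
    rintro _ ⟨m, rfl⟩
    refine ⟨_, fun a ha => ?_, symMonomial_eq_list m⟩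
    obtain ⟨i, _, rfl⟩ := List.mem_map.1 ha
    exact h.smooth hO i

theorem IsVectorBundle.symBundle (hO : IsGermRing O) (hE : IsVectorBundle O E) :
    IsVectorBundle O (symBundle O E) := by
  refine isVectorBundle_of_frames fun x => ?_
  obtain ⟨ι, e, he⟩ := hE x
  exact ⟨ι →₀ ℕ, symMonomial (O := O) e, he.mono fun y h => IsFrameAt.symBundle hO h⟩

theorem symBundle_smoothAt_one (hO : IsGermRing O) (x : X) :
    (ConfBundle.symBundle O E).SmoothAt (fun _ => 1) x :=
  GeneratedAt.of_mem hO (Set.mem_ofPred.2 ⟨[], by simp, by simp⟩) x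

theorem symBundle_smoothAt_mul (hO : IsGermRing O) {s t : (ConfBundle.symBundle O E).Section}
    {x : X} (hs : (ConfBundle.symBundle O E).SmoothAt s x)
    (ht : (ConfBundle.symBundle O E).SmoothAt t x) :
    (ConfBundle.symBundle O E).SmoothAt (fun y => s y * t y) x := by
  refine GeneratedAt.map₂ hO hs ht (fun x => LinearMap.mul 𝕂 _) ?_
  rintro _ ⟨l, hl, rfl⟩ _ ⟨l', hl', rfl⟩
  refine .of_mem hO (Set.mem_ofPred.2 ⟨l ++ l', fun a ha => ?_, by simp⟩) _
  rcases List.mem_append.1 ha with h | h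
  exacts [hl a h, hl' a h]

end Frames

open scoped Classical

/-! ### Topology of the configuration space, splits and labellings -/

section Topology

variable {M : Type u}

theorem mem_q {k : ℕ} {z : Fin k → M} {y : M} : y ∈ q z ↔ ∃ i, z i = y := by
  simp [q]

theorem exists_labelling (c : UConf M) :
    ∃ (k : ℕ) (v : Fin k → M), Function.Injective v ∧ q v = c := by
  refine ⟨c.card, fun i => c.equivFin.symm i,
    Subtype.val_injective.comp c.equivFin.symm.injective, ?_⟩
  ext y
  rw [mem_q]
  exact ⟨fun ⟨i, hi⟩ => hi ▸ (c.equivFin.symm i).2, fun hy => ⟨c.equivFin ⟨y, hy⟩, by simp⟩⟩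

/-- The fibres of `q` on injective tuples are the orbits of relabelling. The two lengths are allowed
to differ a priori; their equality is part of the conclusion. -/
theorem exists_equiv_of_q_eq {k l : ℕ} {v : Fin k → M} {z : Fin l → M}
    (hv : Function.Injective v) (hz : Function.Injective z) (h : q v = q z) :
    ∃ e : Fin k ≃ Fin l, z ∘ e = v := by
  have h1 : ∀ i, ∃ j, z j = v i := fun i => mem_q.1 (h ▸ mem_q.2 ⟨i, rfl⟩)
  choose f hf using h1
  refine ⟨Equiv.ofBijective f ⟨fun i i' e => hv ?_, fun j => ?_⟩, funext hf⟩
  · rw [← hf, ← hf, e]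
  · obtain ⟨i, hi⟩ := mem_q.1 (h.symm ▸ mem_q.2 ⟨j, rfl⟩ : z j ∈ q v)
    exact ⟨i, hz (by rw [hf, hi])⟩

/-- The part of the configuration `c` in `A`. -/
noncomputable def part (A : Set M) (c : UConf M) : UConf M := c.filter (· ∈ A)

@[simp]
theorem mem_part {A : Set M} {c : UConf M} {y : M} : y ∈ part A c ↔ y ∈ c ∧ y ∈ A := by
  simp [part]

/-- The split of `c` into its points inside and outside `A`. -/
@[simps]
noncomputable def splitBy (A : Set M) (c : UConf M) : Split c where
  fst := part A c
  snd := part Aᶜ c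
  disj := Finset.disjoint_left.2 fun _ h h' => (mem_part.1 h').2 (mem_part.1 h).2
  union := by
    ext y
    simp only [Finset.mem_union, mem_part, Set.mem_compl_iff]
    tauto

theorem splitBy_union {A : Set M} {c₁ c₂ : UConf M} (h₁ : (c₁ : Set M) ⊆ A)
    (h₂ : (c₂ : Set M) ⊆ Aᶜ) (h : Disjoint c₁ c₂) :
    splitBy A (c₁ ∪ c₂) = ⟨c₁, c₂, h, rfl⟩ := by
  have e₁ : part A (c₁ ∪ c₂) = c₁ := by
    ext y
    simp only [mem_part, Finset.mem_union]
    exact ⟨fun ⟨h, hA⟩ => h.resolve_right fun h' => h₂ h' hA, fun h => ⟨.inl h, h₁ h⟩⟩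
  have e₂ : part Aᶜ (c₁ ∪ c₂) = c₂ := by
    ext y
    simp only [mem_part, Finset.mem_union]
    exact ⟨fun ⟨h, hA⟩ => h.resolve_left fun h' => hA (h₁ h'), fun h => ⟨.inr h, h₂ h⟩⟩
  simp only [splitBy, e₁, e₂]

theorem Split.ext_fst {c : UConf M} {p p' : Split c} (h : p.fst = p'.fst) : p = p' := by
  obtain ⟨a, b, hd, hu⟩ := p
  obtain ⟨a', b', hd', hu'⟩ := p'
  obtain rfl : a = a' := h
  have : b = b' := by
    rw [← Finset.union_sdiff_cancel_left hd, hu, ← Finset.union_sdiff_cancel_left hd', hu']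
  subst this
  rfl

theorem Split.fst_subset {c : UConf M} (p : Split c) : p.fst ⊆ c :=
  Finset.subset_union_left.trans p.union.subset

instance {c : UConf M} : Finite (Split c) :=
  Finite.of_injective (fun p : Split c => (⟨p.fst, Finset.mem_powerset.2 p.fst_subset⟩ :
    c.powerset)) fun _ _ h => Split.ext_fst (congrArg Subtype.val h)

theorem splitBy_self {ρ : M → M} {c : UConf M} (h : ∀ x ∈ c, ρ x = x) (p : Split c) :
    splitBy (ρ ⁻¹' (p.fst : Set M)) c = p := by
  refine Split.ext_fst (Finset.ext fun x => ?_)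
  simp only [splitBy_fst, mem_part, Set.mem_preimage, Finset.mem_coe]
  refine ⟨fun ⟨hx, h'⟩ => h x hx ▸ h', fun hx => ?_⟩
  have hxc : x ∈ c := p.fst_subset hx
  exact ⟨hxc, by rwa [h x hxc]⟩

variable [TopologicalSpace M]

theorem continuous_q (k : ℕ) : Continuous (fun v : OConf k M => (q v.1 : UConf M)) :=
  (continuous_coinduced_rng (f := fun p : Σ k, OConf k M => q p.2.1)).comp continuous_sigmaMk

/-- The saturation of an open set is the union of its preimages under the relabellings of
coordinates, each of them continuous. For `l ≠ k` there is no relabelling and the union is empty. -/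
theorem isOpenMap_q (k : ℕ) : IsOpenMap (fun v : OConf k M => (q v.1 : UConf M)) := by
  intro U hU
  refine isOpen_coinduced.2 (isOpen_sigma_iff.2 fun l => ?_)
  have : Sigma.mk l ⁻¹' ((fun p : Σ k, OConf k M => q p.2.1) ⁻¹'
      ((fun v : OConf k M => (q v.1 : UConf M)) '' U)) =
      ⋃ e : Fin k ≃ Fin l, (fun w : OConf l M =>
        (⟨w.1 ∘ e, w.2.comp e.injective⟩ : OConf k M)) ⁻¹' U := by
    ext w
    simp only [Set.mem_preimage, Set.mem_image, Set.mem_iUnion]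
    constructor
    · rintro ⟨v, hv, h⟩
      obtain ⟨e, he⟩ := exists_equiv_of_q_eq v.2 w.2 h
      refine ⟨e, ?_⟩
      convert hv
    · rintro ⟨e, he⟩
      refine ⟨_, he, ?_⟩
      ext y
      simp only [mem_q, Function.comp_apply]
      exact ⟨fun ⟨i, h⟩ => ⟨e i, h⟩, fun ⟨i, h⟩ => ⟨e.symm i, by simpa using h⟩⟩
  rw [this]
  refine isOpen_iUnion fun e => hU.preimage ?_
  refine Continuous.subtype_mk (continuous_pi fun i => ?_) _
  exact (continuous_apply (e i)).comp continuous_subtype_val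

/-- `A` contains a neighbourhood of each point of `c` or is disjoint from one. -/
def Cuts (A : Set M) (c : UConf M) : Prop := ∀ x ∈ c, A ∈ 𝓝 x ∨ Aᶜ ∈ 𝓝 x

theorem Cuts.compl {A : Set M} {c : UConf M} (h : Cuts A c) : Cuts Aᶜ c := fun x hx => by
  simpa using (h x hx).symm

/-- Near `v` the set of indices `i` with `z i ∈ A` is constant. Thus passing to the part in `A` is,
in ordered coordinates, a fixed selection `τ` of coordinates; both its continuity and its smoothness
follow from this. -/
theorem q_cuts {k : ℕ} {v : Fin k → M} {A : Set M}
    (hA : Cuts A (q v)) : ∃ (l : ℕ) (τ : Fin l → Fin k), Function.Injective τ ∧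
      ∀ᶠ z in 𝓝 v, part A (q z) = q (z ∘ τ) := by
  let I : Finset (Fin k) := Finset.univ.filter fun i => v i ∈ A
  refine ⟨I.card, fun j => I.equivFin.symm j,
    Subtype.val_injective.comp I.equivFin.symm.injective, ?_⟩
  have h1 : ∀ᶠ z in 𝓝 v, ∀ i, z i ∈ A ↔ v i ∈ A := by
    refine Filter.eventually_all.2 fun i => ?_
    have hc : Filter.Tendsto (fun z : Fin k → M => z i) (𝓝 v) (𝓝 (v i)) :=
      (continuous_apply i).continuousAt
    rcases hA (v i) (mem_q.2 ⟨i, rfl⟩) with h | h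
    · filter_upwards [hc h] with z hz
      exact ⟨fun _ => mem_of_mem_nhds h, fun _ => hz⟩
    · filter_upwards [hc h] with z hz
      exact ⟨fun h' => absurd h' hz, fun h' => absurd h' (mem_of_mem_nhds h)⟩
  filter_upwards [h1] with z hz
  ext y
  simp only [mem_part, mem_q, Function.comp_apply]
  constructor
  · rintro ⟨⟨i, rfl⟩, hi⟩
    exact ⟨I.equivFin ⟨i, by simpa [I] using (hz i).1 hi⟩, by simp⟩
  · rintro ⟨j, rfl⟩
    refine ⟨⟨_, rfl⟩, (hz _).2 ?_⟩
    exact (Finset.mem_filter.1 (I.equivFin.symm j).2).2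

/-- `ρ` is injective on the configuration `c'`, maps it onto `c`, and is constant near each of its
points. -/
structure IsLabelling (ρ : M → M) (c c' : UConf M) : Prop where
  bijOn : Set.BijOn ρ c' c
  eventually_eq : ∀ y ∈ c', ∀ᶠ y' in 𝓝 y, ρ y' = ρ y

theorem IsLabelling.cuts {ρ : M → M} {c c' : UConf M} (h : IsLabelling ρ c c') (S : Set M) :
    Cuts (ρ ⁻¹' S) c' := by
  intro y hy
  by_cases hS : ρ y ∈ S
  · exact .inl (by filter_upwards [h.eventually_eq y hy] with y' e using by simpa [e])
  · exact .inr (by filter_upwards [h.eventually_eq y hy] with y' e using by simpa [e])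

/-- The index set of the sum defining a fibre of `V ⊠ W` is thereby the same for all configurations
labelled by `c`. Surjectivity comes from pushing a split of `c'` forward along `ρ`. -/
theorem IsLabelling.splitBy_bijective {ρ : M → M} {c c' : UConf M} (h : IsLabelling ρ c c') :
    Function.Bijective (fun p : Split c => splitBy (ρ ⁻¹' (p.fst : Set M)) c') := by
  constructor
  · intro p p' e
    refine Split.ext_fst (Finset.ext fun x => ?_)
    have e' := congrArg Split.fst e
    by_cases hx : x ∈ c
    · obtain ⟨y, hy, rfl⟩ := h.bijOn.surjOn hx
      have := Finset.ext_iff.1 e' y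
      simp only [splitBy_fst, mem_part, Set.mem_preimage, Finset.mem_coe] at this
      simpa [Finset.mem_coe.1 hy] using this
    · exact ⟨fun h' => absurd (p.fst_subset h') hx, fun h' => absurd (p'.fst_subset h') hx⟩
  · intro p'
    have hc' : ∀ y, y ∈ c' ↔ y ∈ p'.fst ∨ y ∈ p'.snd := fun y => by
      rw [← Finset.mem_union, p'.union]
    refine ⟨⟨p'.fst.image ρ, p'.snd.image ρ, ?_, ?_⟩, Split.ext_fst (Finset.ext fun y => ?_)⟩
    · rw [Finset.disjoint_left]
      intro x hx hx'
      obtain ⟨y, hy, rfl⟩ := Finset.mem_image.1 hx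
      obtain ⟨y', hy', e⟩ := Finset.mem_image.1 hx'
      have := h.bijOn.injOn ((hc' _).2 (.inr hy')) ((hc' _).2 (.inl hy)) e
      exact Finset.disjoint_left.1 p'.disj hy (this ▸ hy')
    · rw [← Finset.image_union, p'.union]
      exact Finset.coe_injective (by rw [Finset.coe_image]; exact h.bijOn.image_eq)
    · simp only [splitBy_fst, mem_part, Set.mem_preimage, Finset.mem_coe,
        Finset.mem_image]
      constructor
      · rintro ⟨hy, y', hy', e⟩
        exact h.bijOn.injOn ((hc' _).2 (.inl hy')) hy e ▸ hy'
      · intro hy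
        exact ⟨(hc' y).2 (.inl hy), y, hy, rfl⟩

variable [T2Space M]

/-- The Hausdorff property makes each condition `z i ≠ z j` open, and there are finitely many of
them. -/
theorem eventually_injective {k : ℕ} {v : Fin k → M} (hv : Function.Injective v) :
    ∀ᶠ z in 𝓝 v, Function.Injective z := by
  have : ∀ i j : Fin k, ∀ᶠ z in 𝓝 v, i ≠ j → z i ≠ z j := by
    intro i j
    by_cases h : i = j
    · simp [h]
    have ho : IsOpen {z : Fin k → M | z i ≠ z j} :=
      isOpen_ne_fun (continuous_apply i) (continuous_apply j)
    filter_upwards [ho.mem_nhds (show v i ≠ v j from fun e => h (hv e))] with z hz _ using hz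
  filter_upwards [Filter.eventually_all.2 fun i => Filter.eventually_all.2 (this i)] with z hz
  intro i j e
  by_contra h
  exact hz i j h e

/-- Statements that hold near a configuration become statements near a single ordering of it. The
map `q` is continuous and open on ordered configurations, and these are a neighbourhood of `v` among
all tuples. -/
theorem nhds_q {k : ℕ} {v : Fin k → M} (hv : Function.Injective v) :
    𝓝 (q v : UConf M) = Filter.map q (𝓝 v) := by
  have h1 := (isOpenMap_q (M := M) k).map_nhds_eq (x := ⟨v, hv⟩) (continuous_q k).continuousAt
  have h2 : Filter.map ((↑) : OConf k M → (Fin k → M)) (𝓝 ⟨v, hv⟩) = 𝓝 v :=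
    map_nhds_subtype_coe_eq_nhds hv (eventually_injective hv)
  rw [← h1, ← h2, Filter.map_map]
  rfl

theorem eventually_subset {c : UConf M} {U : Set M} (h : ∀ x ∈ c, U ∈ 𝓝 x) :
    ∀ᶠ c' : UConf M in 𝓝 c, (c' : Set M) ⊆ U := by
  obtain ⟨k, v, hv, rfl⟩ := exists_labelling c
  rw [nhds_q hv, Filter.eventually_map]
  have : ∀ᶠ z in 𝓝 v, ∀ i, z i ∈ U := Filter.eventually_all.2 fun i =>
    (continuous_apply i).continuousAt (h (v i) (mem_q.2 ⟨i, rfl⟩))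
  filter_upwards [this] with z hz y hy
  obtain ⟨i, rfl⟩ := mem_q.1 hy
  exact hz i

theorem tendsto_filter {A : Set M} {c : UConf M} (hA : Cuts A c) :
    Filter.Tendsto (fun c' : UConf M => part A c') (𝓝 c) (𝓝 (part A c)) := by
  obtain ⟨k, v, hv, rfl⟩ := exists_labelling c
  obtain ⟨l, τ, hτ, h⟩ := q_cuts hA
  rw [h.self_of_nhds, nhds_q hv, nhds_q (hv.comp hτ), Filter.tendsto_map'_iff]
  refine Filter.Tendsto.congr' (h.mono fun z hz => hz.symm) (Filter.tendsto_map.comp ?_)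
  exact (continuous_pi fun i => continuous_apply (τ i)).continuousAt

theorem tendsto_splitBy {A : Set M} {c : UConf M} (hA : Cuts A c) :
    Filter.Tendsto (fun c' : UConf M => ((splitBy A c').fst, (splitBy A c').snd)) (𝓝 c)
      (𝓝 ((splitBy A c).fst, (splitBy A c).snd)) :=
  (tendsto_filter hA).prodMk_nhds (tendsto_filter hA.compl)

/-- The points of the configurations near `c` can be labelled by the points of `c`, in a locally
constant way. -/
theorem exists_isLabelling (c : UConf M) : ∃ ρ : M → M, (∀ x ∈ c, ρ x = x) ∧
    ∀ᶠ c' in 𝓝 c, IsLabelling ρ c c' := by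
  obtain ⟨U, hU, hd⟩ := (c.finite_toSet).t2_separation
  -- Each of the disjoint neighbourhoods `U x` is collapsed to its centre. The value `y` elsewhere
  -- is an irrelevant default.
  let ρ : M → M := fun y => if h : ∃ x ∈ c, y ∈ U x then h.choose else y
  have hρ : ∀ x ∈ c, ∀ y ∈ U x, ρ y = x := by
    intro x hx y hy
    have h : ∃ x ∈ c, y ∈ U x := ⟨x, hx, hy⟩
    simp only [ρ, dif_pos h]
    by_contra hne
    exact Set.disjoint_left.1 (hd h.choose_spec.1 hx hne) h.choose_spec.2 hy
  refine ⟨ρ, fun x hx => hρ x hx x (hU x).1, ?_⟩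
  obtain ⟨k, v, hv, rfl⟩ := exists_labelling c
  have hvq : ∀ i, v i ∈ q v := fun i => mem_q.2 ⟨i, rfl⟩
  rw [nhds_q hv, Filter.eventually_map]
  have : ∀ᶠ z in 𝓝 v, ∀ i, z i ∈ U (v i) := Filter.eventually_all.2 fun i =>
    (continuous_apply i).continuousAt ((hU (v i)).2.mem_nhds (hU (v i)).1)
  filter_upwards [this] with z hz
  have hρz : ∀ i, ρ (z i) = v i := fun i => hρ _ (hvq i) _ (hz i)
  refine ⟨⟨?_, ?_, ?_⟩, ?_⟩
  · intro y hy
    obtain ⟨i, rfl⟩ := mem_q.1 hy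
    rw [hρz]
    exact hvq i
  · intro y hy y' hy' e
    obtain ⟨i, rfl⟩ := mem_q.1 hy
    obtain ⟨j, rfl⟩ := mem_q.1 hy'
    rw [hρz, hρz] at e
    rw [hv e]
  · intro x hx
    obtain ⟨i, rfl⟩ := mem_q.1 hx
    exact ⟨z i, mem_q.2 ⟨i, rfl⟩, hρz i⟩
  · intro y hy
    obtain ⟨i, rfl⟩ := mem_q.1 hy
    filter_upwards [(hU (v i)).2.mem_nhds (hz i)] with y' hy'
    rw [hρz, hρ _ (hvq i) _ hy']

/-- A split of `c` extends to all nearby configurations by cutting them along one set `A`; this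
replaces the unique nearby decompositions in the definition of `cauchy`. -/
theorem exists_cuts {c : UConf M} (p : Split c) : ∃ A : Set M, Cuts A c ∧ splitBy A c = p := by
  obtain ⟨ρ, h, h'⟩ := exists_isLabelling c
  exact ⟨_, h'.self_of_nhds.cuts _, splitBy_self h p⟩

end Topology

/-! ### Smooth functions on `M` and on the configuration space -/

section Smooth

variable {𝕂 : Type v} [RCLike 𝕂] {M : Type u} [TopologicalSpace M] {d : ℕ}
  [ChartedSpace (EuclideanSpace ℝ (Fin d)) M]

theorem contMDiffAt_mul {E H N : Type*} [NormedAddCommGroup E] [NormedSpace ℝ E]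
    [TopologicalSpace H] {I : ModelWithCorners ℝ E H} [TopologicalSpace N] [ChartedSpace H N]
    {f g : N → 𝕂} {x : N} (hf : ContMDiffAt I 𝓘(ℝ, 𝕂) ∞ f x) (hg : ContMDiffAt I 𝓘(ℝ, 𝕂) ∞ g x) :
    ContMDiffAt I 𝓘(ℝ, 𝕂) ∞ (fun y => f y * g y) x :=
  (contDiff_mul (𝕜 := ℝ) (𝔸 := 𝕂)).contMDiff.contMDiffAt.comp x (hf.prodMk_space hg)

theorem contMDiffAt_add {E H N : Type*} [NormedAddCommGroup E] [NormedSpace ℝ E]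
    [TopologicalSpace H] {I : ModelWithCorners ℝ E H} [TopologicalSpace N] [ChartedSpace H N]
    {f g : N → 𝕂} {x : N} (hf : ContMDiffAt I 𝓘(ℝ, 𝕂) ∞ f x) (hg : ContMDiffAt I 𝓘(ℝ, 𝕂) ∞ g x) :
    ContMDiffAt I 𝓘(ℝ, 𝕂) ∞ (fun y => f y + g y) x :=
  (contDiff_add (𝕜 := ℝ) (F := 𝕂)).contMDiff.contMDiffAt.comp x (hf.prodMk_space hg)

theorem isGermRing_smoothFun : IsGermRing (smoothFun (𝕂 := 𝕂) (M := M) d) where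
  const r x := .of_forall fun y => contMDiffAt_const
  add hf hg := by filter_upwards [hf, hg] with y h h' using contMDiffAt_add h h'
  mul hf hg := by filter_upwards [hf, hg] with y h h' using contMDiffAt_mul h h'
  congr h hf := by
    filter_upwards [hf, eventually_eventually_nhds.2 h] with y h h'
    exact h.congr_of_eventuallyEq (h'.mono fun _ e => e.symm)

theorem mem_extChartAt_pi_target {k : ℕ} {v : Fin k → M} {x : Fin k → EuclideanSpace ℝ (Fin d)}
    (h : x ∈ (extChartAt (ModelWithCorners.pi fun _ : Fin k => 𝓡 d) v).target) (i : Fin k) :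
    x i ∈ (extChartAt (𝓡 d) (v i)).target := by
  have h2 : (ModelWithCorners.pi fun _ : Fin k => 𝓡 d).symm x ∈
      (chartAt (ModelPi fun _ : Fin k => EuclideanSpace ℝ (Fin d)) v).target := h.2
  refine ⟨trivial, ?_⟩
  exact h2 i trivial

theorem contMDiffAt_pi_apply {k : ℕ} (v : Fin k → M) (i : Fin k) :
    ContMDiffAt (ModelWithCorners.pi fun _ : Fin k => 𝓡 d) (𝓡 d) ∞
      (fun z : Fin k → M => z i) v := by
  refine contMDiffAt_iff.2 ⟨(continuous_apply i).continuousAt, ?_⟩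
  refine ContDiffWithinAt.congr_of_eventuallyEq_of_mem
    (f := fun x : Fin k → EuclideanSpace ℝ (Fin d) => x i)
    (contDiff_apply ℝ _ i).contDiffWithinAt ?_ (Set.mem_range_self _)
  filter_upwards [extChartAt_target_mem_nhdsWithin v] with x hx
  exact (extChartAt (𝓡 d) (v i)).right_inv (mem_extChartAt_pi_target hx i)

/-- The charts of `M^k` are products of charts of `M`, so in the charts at `v` and `v ∘ τ` the map
is a linear selection of coordinates. -/
theorem contMDiffAt_pi_reindex {k l : ℕ} (v : Fin k → M) (τ : Fin l → Fin k) :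
    ContMDiffAt (ModelWithCorners.pi fun _ : Fin k => 𝓡 d)
      (ModelWithCorners.pi fun _ : Fin l => 𝓡 d) ∞ (fun z : Fin k → M => z ∘ τ) v := by
  refine contMDiffAt_iff.2 ⟨(continuous_pi fun i => continuous_apply (τ i)).continuousAt, ?_⟩
  refine ContDiffWithinAt.congr_of_eventuallyEq_of_mem
    (f := fun x : Fin k → EuclideanSpace ℝ (Fin d) => fun i : Fin l => x (τ i))
    (contDiff_pi.2 fun i => contDiff_apply ℝ _ (τ i)).contDiffWithinAt ?_ (Set.mem_range_self _)
  filter_upwards [extChartAt_target_mem_nhdsWithin v] with x hx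
  funext i
  exact (extChartAt (𝓡 d) (v (τ i))).right_inv (mem_extChartAt_pi_target hx (τ i))

/-- The restriction of a smooth function to the part of the configurations in `A`. -/
theorem smoothConf_filter {A : Set M} {c : UConf M} (hA : Cuts A c) {f : UConf M → 𝕂}
    (hf : smoothConf d f (part A c)) :
    smoothConf d (fun c' => f (part A c')) c := by
  rintro k v hv rfl
  obtain ⟨l, τ, hτ, h⟩ := q_cuts hA
  have h1 := hf l (v ∘ τ) (hv.comp hτ) h.self_of_nhds.symm
  have hc : Filter.Tendsto (fun z : Fin k → M => z ∘ τ) (𝓝 v) (𝓝 (v ∘ τ)) :=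
    (continuous_pi fun i => continuous_apply (τ i)).continuousAt
  filter_upwards [hc.eventually h1, eventually_eventually_nhds.2 h] with z hz hz'
  refine ContMDiffAt.congr_of_eventuallyEq (hz.comp z (contMDiffAt_pi_reindex z τ)) ?_
  filter_upwards [hz'] with t ht
  simp only [ht, Function.comp_apply]

variable [T2Space M]

theorem isGermRing_smoothConf : IsGermRing (smoothConf (𝕂 := 𝕂) (M := M) d) where
  const r x k v hv e := .of_forall fun y => contMDiffAt_const
  add hf hg k v hv e := by
    filter_upwards [hf k v hv e, hg k v hv e] with y h h' using contMDiffAt_add h h'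
  mul hf hg k v hv e := by
    filter_upwards [hf k v hv e, hg k v hv e] with y h h' using contMDiffAt_mul h h'
  congr h hf k v hv e := by
    subst e
    rw [Filter.EventuallyEq, nhds_q hv, Filter.eventually_map] at h
    filter_upwards [hf k v hv rfl, eventually_eventually_nhds.2 h] with y h h'
    exact h.congr_of_eventuallyEq (h'.mono fun _ e => e.symm)

/-- These are the coefficients that appear when `⊡` of linear combinations is expanded. On injective
tuples the product over the configuration is the product over the coordinates, since no point is
counted twice. -/
theorem smoothConf_prod {c : UConf M} {f : M → 𝕂} (hf : ∀ x ∈ c, smoothFun d f x) :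
    smoothConf d (fun c' => ∏ y ∈ c', f y) c := by
  rintro k v hv rfl
  have h1 : ∀ᶠ z in 𝓝 v, ∀ i, ContMDiffAt (𝓡 d) 𝓘(ℝ, 𝕂) ∞ f (z i) :=
    Filter.eventually_all.2 fun i =>
      (continuous_apply i).continuousAt.eventually (hf (v i) (mem_q.2 ⟨i, rfl⟩))
  filter_upwards [h1, eventually_eventually_nhds.2 (eventually_injective hv)] with z hz hz'
  have h2 : ∀ t : Finset (Fin k), ContMDiffAt (ModelWithCorners.pi fun _ : Fin k => 𝓡 d)
      𝓘(ℝ, 𝕂) ∞ (fun z : Fin k → M => ∏ i ∈ t, f (z i)) z := by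
    intro t
    induction t using Finset.induction_on with
    | empty => simpa using contMDiffAt_const
    | insert i t hi ih =>
      simp only [Finset.prod_insert hi]
      exact contMDiffAt_mul ((hz i).comp z (contMDiffAt_pi_apply z i)) ih
  refine (h2 Finset.univ).congr_of_eventuallyEq ?_
  filter_upwards [hz'] with t ht
  rw [q, Finset.prod_image ht.injOn]

end Smooth

/-! ### Fibres of `S^⊠(E)` as unordered tensor products -/

section Fibre

variable {𝕂 : Type v} [RCLike 𝕂] {M : Type u}

/-- A labelling of `c` as a bijection. -/
noncomputable def Labelling.equiv {c : UConf M} (p : Labelling c) : Fin p.card ≃ c :=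
  Equiv.ofBijective (fun i => ⟨p.pt i, p.eq.subset (mem_q.2 ⟨i, rfl⟩)⟩)
    ⟨fun i j h => p.inj (congrArg Subtype.val h), fun x => by
      obtain ⟨i, hi⟩ := mem_q.1 (p.eq.superset x.2 : x.1 ∈ q p.pt)
      exact ⟨i, Subtype.ext hi⟩⟩

theorem Labelling.nonempty (c : UConf M) : Nonempty (Labelling c) := by
  obtain ⟨k, v, hv, e⟩ := exists_labelling c
  exact ⟨⟨k, v, hv, e⟩⟩

/-- Some labelling of a configuration. -/
noncomputable def someLabelling (c : UConf M) : Labelling c :=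
  Classical.choice (Labelling.nonempty c)

variable (E : Family.{u, v, w} 𝕂 M)

/-- The unordered tensor product `⨂_{x ∈ c} E_x`. -/
abbrev PiFib (c : UConf M) : Type (max u v w) := ⨂[𝕂] x : c, E.Fib x

/-- The unordered tensor product is the tensor product over any ordering. -/
noncomputable def piFibEquiv {c : UConf M} (p : Labelling c) :
    (PiFib E c) ≃ₗ[𝕂] ⨂[𝕂] i : Fin p.card, E.Fib (p.pt i) :=
  PiTensorProduct.reindex 𝕂 (fun x : c => E.Fib x) p.equiv.symm

theorem piFibEquiv_tprod {c : UConf M} (p : Labelling c) (a : E.Section) :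
    piFibEquiv E p (PiTensorProduct.tprod 𝕂 fun x : c => a x) =
      PiTensorProduct.tprod 𝕂 fun i => a (p.pt i) :=
  PiTensorProduct.reindex_tprod _ _

theorem piFibEquiv_symm_tprod {c : UConf M} (p : Labelling c) (a : E.Section) :
    (piFibEquiv E p).symm (PiTensorProduct.tprod 𝕂 fun i => a (p.pt i)) =
      PiTensorProduct.tprod 𝕂 fun x : c => a x := by
  rw [← piFibEquiv_tprod, LinearEquiv.symm_apply_apply]

variable {E} in
theorem exists_section_eq {c : UConf M} (f : ∀ x : c, E.Fib x) :
    ∃ a : E.Section, (fun x : c => a x) = f :=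
  ⟨fun x => if h : x ∈ c then f ⟨x, h⟩ else 0, funext fun x => by simp⟩

variable {E} in
theorem exists_section_labelling_eq {c : UConf M} (p : Labelling c)
    (f : ∀ i, E.Fib (p.pt i)) : ∃ a : E.Section, (fun i => a (p.pt i)) = f := by
  refine ⟨fun x => if h : ∃ i, p.pt i = x then h.choose_spec ▸ f h.choose else 0,
    funext fun i => ?_⟩
  have h : ∃ j, p.pt j = p.pt i := ⟨i, rfl⟩
  refine (dif_pos h).trans ?_
  -- The chosen index is only known to have the same point as `i`; injectivity of the labelling
  -- identifies the two and removes the transport.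
  have : ∀ (j : Fin p.card) (e : p.pt j = p.pt i), (e ▸ f j : E.Fib (p.pt i)) = f i := by
    intro j e
    obtain rfl := p.inj e
    rfl
  exact this _ _

variable {E} in
/-- Linear maps on `⨂_{x ∈ c} E_x` are equal if they agree on the products of sections. -/
theorem piFib_ext {c : UConf M} {N : Type*} [AddCommMonoid N] [Module 𝕂 N]
    {f g : PiFib E c →ₗ[𝕂] N} (h : ∀ a : E.Section,
      f (PiTensorProduct.tprod 𝕂 fun x : c => a x) =
        g (PiTensorProduct.tprod 𝕂 fun x : c => a x)) : f = g := by
  refine PiTensorProduct.ext (MultilinearMap.ext fun m => ?_)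
  obtain ⟨a, rfl⟩ := exists_section_eq m
  exact h a

/-- The map `T^⊠(E)_c → ⨂_{x ∈ c} E_x` forgetting the orderings. -/
noncomputable def tensorToPi (c : UConf M) : TensorFib E c →ₗ[𝕂] PiFib E c :=
  DirectSum.toModule 𝕂 _ _ fun p => (piFibEquiv E p).symm.toLinearMap

theorem tensorToPi_tens {c : UConf M} (a : E.Section) (p : Labelling c) :
    tensorToPi E c (tens E a p) = PiTensorProduct.tprod 𝕂 fun x : c => a x := by
  rw [tensorToPi, tens, DirectSum.toModule_lof]
  exact piFibEquiv_symm_tprod E p a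

variable {E} in
theorem tensorFib_ext {c : UConf M} {N : Type*} [AddCommMonoid N] [Module 𝕂 N]
    {f g : TensorFib E c →ₗ[𝕂] N} (h : ∀ (a : E.Section) (p : Labelling c),
      f (tens E a p) = g (tens E a p)) : f = g := by
  refine DirectSum.linearMap_ext 𝕂 fun p => PiTensorProduct.ext (MultilinearMap.ext fun m => ?_)
  obtain ⟨a, rfl⟩ := exists_section_labelling_eq p m
  exact h a p

theorem symRel_le_ker (c : UConf M) : symRel E c ≤ LinearMap.ker (tensorToPi E c) := by
  refine Submodule.span_le.2 ?_
  rintro _ ⟨a, p, σ, rfl⟩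
  simp [tensorToPi_tens]

/-- Because of this, formulas for products over disjoint configurations lose no generality by using
one section in both factors. -/
theorem exists_section_union {c₁ c₂ : UConf M} (h : Disjoint c₁ c₂) (a b : E.Section) :
    ∃ e : E.Section, (∀ x ∈ c₁, e x = a x) ∧ ∀ x ∈ c₂, e x = b x :=
  ⟨fun x => if x ∈ c₁ then a x else b x, fun x hx => by simp [hx],
    fun x hx => by simp [Finset.disjoint_right.1 h hx]⟩

/-- The bijection between the disjoint union of the parts of a split and the configuration. -/
noncomputable def Split.equiv {c : UConf M} (s : Split c) : s.fst ⊕ s.snd ≃ c :=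
  Equiv.ofBijective (Sum.elim (fun x => ⟨x.1, s.union.subset (Finset.mem_union_left _ x.2)⟩)
      (fun x => ⟨x.1, s.union.subset (Finset.mem_union_right _ x.2)⟩))
    ⟨by
      rintro (x | x) (y | y) h
      · exact congrArg Sum.inl (Subtype.ext (show x.1 = y.1 from congrArg (fun z : c => z.1) h))
      · exact absurd y.2 (Finset.disjoint_left.1 s.disj
          ((show x.1 = y.1 from congrArg (fun z : c => z.1) h) ▸ x.2))
      · exact absurd x.2 (Finset.disjoint_left.1 s.disj
          ((show x.1 = y.1 from congrArg (fun z : c => z.1) h) ▸ y.2))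
      · exact congrArg Sum.inr (Subtype.ext (show x.1 = y.1 from
            congrArg (fun z : c => z.1) h)), fun x => by
      rcases Finset.mem_union.1 (s.union.superset x.2 : x.1 ∈ s.fst ∪ s.snd) with h | h
      · exact ⟨.inl ⟨x.1, h⟩, rfl⟩
      · exact ⟨.inr ⟨x.1, h⟩, rfl⟩⟩

/-- The multiplication `⨂_{x ∈ c'} E_x ⊗ ⨂_{x ∈ c''} E_x → ⨂_{x ∈ c} E_x` for a split of `c`. -/
noncomputable def piMul {c : UConf M} (s : Split c) :
    PiFib E s.fst ⊗[𝕂] PiFib E s.snd →ₗ[𝕂] PiFib E c :=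
  (PiTensorProduct.reindex 𝕂 (fun x : c => E.Fib x) s.equiv.symm).symm.toLinearMap ∘ₗ
    (PiTensorProduct.tmulEquivDep 𝕂 (fun j => E.Fib (s.equiv j))).toLinearMap

theorem piMul_tprod {c : UConf M} (s : Split c) (a : E.Section) :
    piMul E s ((PiTensorProduct.tprod 𝕂 fun x : s.fst => a x) ⊗ₜ[𝕂]
      (PiTensorProduct.tprod 𝕂 fun x : s.snd => a x)) =
      PiTensorProduct.tprod 𝕂 fun x : c => a x := by
  have h1 := PiTensorProduct.tmulEquivDep_apply (R := 𝕂) (N := fun j => E.Fib (s.equiv j))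
    (fun x : s.fst => a x) (fun x : s.snd => a x)
  have h2 := PiTensorProduct.reindex_tprod (R := 𝕂) (s := fun x : c => E.Fib x) s.equiv.symm
    (fun x => a x)
  refine (LinearEquiv.symm_apply_eq _).2 (Eq.trans ?_ h2.symm)
  refine h1.trans ?_
  congr 1
  funext j
  rcases j with j | j <;> rfl

variable [TopologicalSpace M] (d : ℕ) [ChartedSpace (EuclideanSpace ℝ (Fin d)) M]

/-- Two orderings of `c` differ by a permutation, so the difference of the two tensors is one of the
generators of `symRel`. -/
theorem boxdot_eq {c : UConf M} (a : E.Section) (p r : Labelling c) :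
    boxdot d E a p = boxdot d E a r := by
  obtain ⟨k, v, hv, hq⟩ := p
  obtain ⟨l, z, hz, hq'⟩ := r
  obtain ⟨e, he⟩ := exists_equiv_of_q_eq hv hz (hq.trans hq'.symm)
  obtain rfl : k = l := by simpa using Fintype.card_congr e
  subst he
  symm
  rw [← sub_eq_zero, boxdot, boxdot, ← map_sub, Submodule.mkQ_apply, Submodule.Quotient.mk_eq_zero]
  exact Submodule.subset_span ⟨a, ⟨k, z, hz, hq'⟩, e, rfl⟩

/-- The product `⊡_{x ∈ c} a(x)` of the values of a section, which does not depend on an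
ordering. -/
noncomputable def boxdotSection (a : E.Section) : (cauchySym d E).Section :=
  fun c => boxdot d E a (someLabelling c)

theorem boxdot_eq_section {c : UConf M} (a : E.Section) (p : Labelling c) :
    boxdot d E a p = boxdotSection E d a c := boxdot_eq E d a p _

/-- The fibre of `S^⊠(E)` is the unordered tensor product. -/
noncomputable def fibEquiv (c : UConf M) : (cauchySym d E).Fib c ≃ₗ[𝕂] PiFib E c :=
  LinearEquiv.ofLinearMap ((symRel E c).liftQ (tensorToPi E c) (symRel_le_ker E c))
    -- The inverse uses one arbitrary ordering; by `boxdot_eq` the resulting class does not depend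
    -- on it.
    ((symRel E c).mkQ ∘ₗ DirectSum.lof 𝕂 (Labelling c)
      (fun p => ⨂[𝕂] i : Fin p.card, E.Fib (p.pt i)) (someLabelling c) ∘ₗ
      (piFibEquiv E (someLabelling c)).toLinearMap)
    (piFib_ext fun a => by
      simp only [LinearMap.comp_apply, LinearEquiv.coe_coe, piFibEquiv_tprod, LinearMap.id_apply]
      rw [Submodule.mkQ_apply, Submodule.liftQ_apply]
      exact tensorToPi_tens E a _)
    (Submodule.linearMap_qext _ (tensorFib_ext fun a p => by
      change (symRel E c).mkQ (DirectSum.lof 𝕂 (Labelling c) _ (someLabelling c)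
        (piFibEquiv E (someLabelling c) (tensorToPi E c (tens E a p)))) = _
      rw [tensorToPi_tens, piFibEquiv_tprod]
      exact boxdot_eq E d a _ _))

@[simp]
theorem fibEquiv_boxdotSection (a : E.Section) (c : UConf M) :
    fibEquiv E d c (boxdotSection E d a c) = PiTensorProduct.tprod 𝕂 fun x : c => a x :=
  (Submodule.liftQ_apply _ _ _).trans (tensorToPi_tens E a _)

@[simp]
theorem fibEquiv_symm_tprod (a : E.Section) (c : UConf M) :
    (fibEquiv E d c).symm (PiTensorProduct.tprod 𝕂 fun x : c => a x) = boxdotSection E d a c := by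
  rw [← fibEquiv_boxdotSection E d, LinearEquiv.symm_apply_apply]

variable {E d} in
/-- Linear maps on the fibres of `S^⊠(E)` are equal if they agree on the products of sections. -/
theorem cauchySym_ext {c : UConf M} {N : Type*} [AddCommMonoid N] [Module 𝕂 N]
    {f g : (cauchySym d E).Fib c →ₗ[𝕂] N} (h : ∀ a : E.Section,
      f (boxdotSection E d a c) = g (boxdotSection E d a c)) : f = g := by
  have : f ∘ₗ (fibEquiv E d c).symm.toLinearMap = g ∘ₗ (fibEquiv E d c).symm.toLinearMap :=
    piFib_ext fun a => by
      rw [LinearMap.comp_apply, LinearMap.comp_apply, LinearEquiv.coe_coe, fibEquiv_symm_tprod, h]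
  refine LinearMap.ext fun t => ?_
  obtain ⟨t, rfl⟩ := (fibEquiv E d c).symm.surjective t
  exact LinearMap.congr_fun this t

theorem boxdotSection_congr {a b : E.Section} {c : UConf M} (h : ∀ x ∈ c, a x = b x) :
    boxdotSection E d a c = boxdotSection E d b c := by
  apply (fibEquiv E d c).injective
  rw [fibEquiv_boxdotSection, fibEquiv_boxdotSection]
  exact congrArg _ (funext fun x => h x x.2)

/-! ### The Cauchy product -/

/-- The `⊠`-multiplication of `S^⊠(E)`. -/
noncomputable def cauchySymMul (c : UConf M) :
    (cauchy d (cauchySym d E) (cauchySym d E)).Fib c →ₗ[𝕂] (cauchySym d E).Fib c :=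
  DirectSum.toModule 𝕂 _ _ fun s => (fibEquiv E d c).symm.toLinearMap ∘ₗ piMul E s ∘ₗ
    TensorProduct.map (fibEquiv E d s.fst).toLinearMap (fibEquiv E d s.snd).toLinearMap

theorem cauchySymMul_inc {c : UConf M} (s : Split c) (a : E.Section) :
    cauchySymMul E d c (inc _ _ s
      (boxdotSection E d a s.fst ⊗ₜ[𝕂] boxdotSection E d a s.snd)) = boxdotSection E d a c := by
  rw [cauchySymMul, inc, DirectSum.toModule_lof]
  rw [LinearMap.comp_apply, LinearMap.comp_apply, TensorProduct.map_tmul, LinearEquiv.coe_coe,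
    LinearEquiv.coe_coe, LinearEquiv.coe_coe, fibEquiv_boxdotSection, fibEquiv_boxdotSection,
    piMul_tprod, fibEquiv_symm_tprod]

theorem cauchySymMul_inc_of_eq {c : UConf M} (s : Split c) {a b e : E.Section}
    (ha : ∀ x ∈ s.fst, e x = a x) (hb : ∀ x ∈ s.snd, e x = b x) :
    cauchySymMul E d c (inc _ _ s
      (boxdotSection E d a s.fst ⊗ₜ[𝕂] boxdotSection E d b s.snd)) = boxdotSection E d e c := by
  rw [← cauchySymMul_inc E d s e, boxdotSection_congr E d ha, boxdotSection_congr E d hb]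

end Fibre

/-! ### The Hadamard product and unit of `S^⊠ S^⊗(V)` -/

section Hadamard

variable {𝕂 : Type v} [RCLike 𝕂] {M : Type u} [TopologicalSpace M] (d : ℕ)
  [ChartedSpace (EuclideanSpace ℝ (Fin d)) M] (V : Family.{u, v, w} 𝕂 M)

/-- The `⊗`-multiplication of `S^⊠ S^⊗(V)`. -/
noncomputable def cauchyHadamardMul (c : UConf M) :
    (cauchyHadamard d V).Fib c ⊗[𝕂] (cauchyHadamard d V).Fib c →ₗ[𝕂]
      (cauchyHadamard d V).Fib c :=
  (fibEquiv (symBundle (smoothFun d) V) d c).symm.toLinearMap ∘ₗ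
    TensorProduct.lift (PiTensorProduct.mul (R := 𝕂)
      (A := fun x : c => SymmetricAlgebra 𝕂 (V.Fib x))) ∘ₗ
    TensorProduct.map (fibEquiv (symBundle (smoothFun d) V) d c).toLinearMap
      (fibEquiv (symBundle (smoothFun d) V) d c).toLinearMap

theorem cauchyHadamardMul_tmul (a b : (symBundle (smoothFun d) V).Section) (c : UConf M) :
    cauchyHadamardMul d V c (boxdotSection (symBundle (smoothFun d) V) d a c ⊗ₜ[𝕂]
      boxdotSection (symBundle (smoothFun d) V) d b c) =
      boxdotSection (symBundle (smoothFun d) V) d (fun x => a x * b x) c := by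
  rw [cauchyHadamardMul, LinearMap.comp_apply, LinearMap.comp_apply, TensorProduct.map_tmul,
    LinearEquiv.coe_coe, LinearEquiv.coe_coe, fibEquiv_boxdotSection, fibEquiv_boxdotSection,
    TensorProduct.lift.tmul]
  exact (congrArg _ (PiTensorProduct.mul_tprod_tprod (R := 𝕂)
    (A := fun x : c => SymmetricAlgebra 𝕂 (V.Fib x)) (fun x => a x) (fun x => b x))).trans
    (fibEquiv_symm_tprod (symBundle (smoothFun d) V) d (fun x => a x * b x) c)

/-- The `⊗`-unit of `S^⊠ S^⊗(V)`. -/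
noncomputable def cauchyHadamardOne (c : UConf M) : 𝕂 →ₗ[𝕂] (cauchyHadamard d V).Fib c :=
  LinearMap.toSpanSingleton 𝕂 _ (boxdotSection (symBundle (smoothFun d) V) d (fun _ => 1) c)

theorem cauchyHadamardOne_apply (c : UConf M) (r : 𝕂) : cauchyHadamardOne d V c r =
    r • boxdotSection (symBundle (smoothFun d) V) d (fun _ => 1) c := rfl

end Hadamard

/-! ### Gluing sections along a labelling -/

section Auxiliary

variable {M : Type u}

/-- The section given near each point `x` of `c` by a member of a family of sections. -/
noncomputable def glue {F : M → Type*} [∀ x, Zero (F x)] (ρ : M → M) {c : UConf M} {ι : c → Type*}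
    (e : ∀ x, ι x → ∀ y, F y) (J : ∀ x : c, ι x) (y : M) : F y :=
  if h : ρ y ∈ c then e ⟨ρ y, h⟩ (J ⟨ρ y, h⟩) y else 0

theorem glue_apply {F : M → Type*} [∀ x, Zero (F x)] {ρ : M → M} {c : UConf M} {ι : c → Type*}
    (e : ∀ x, ι x → ∀ y, F y) (J : ∀ x : c, ι x) {y : M} (h : ρ y ∈ c) :
    glue ρ e J y = e ⟨ρ y, h⟩ (J ⟨ρ y, h⟩) y := dif_pos h

/-- Since `ρ` is constant near `y`, the choice of section is frozen there, so smoothness of the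
glued section reduces to that of a single member. -/
theorem glue_eventuallyEq [TopologicalSpace M] {F : M → Type*} [∀ x, Zero (F x)] {ρ : M → M}
    {c c' : UConf M} (hρ : IsLabelling ρ c c') {ι : c → Type*} (e : ∀ x, ι x → ∀ y, F y)
    (J : ∀ x : c, ι x) {y : M} (hy : y ∈ c') : ∀ᶠ z in 𝓝 y,
      glue ρ e J z = e ⟨ρ y, hρ.bijOn.mapsTo hy⟩ (J ⟨ρ y, hρ.bijOn.mapsTo hy⟩) z := by
  filter_upwards [hρ.eventually_eq y hy] with z hz
  have h : ρ z ∈ c := by rw [hz]; exact hρ.bijOn.mapsTo hy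
  rw [glue_apply e J h]
  have : ∀ x : c, ⟨ρ z, h⟩ = x → e ⟨ρ z, h⟩ (J ⟨ρ z, h⟩) z = e x (J x) z := by
    rintro _ rfl
    rfl
  exact this _ (Subtype.ext hz)

theorem dfinsupp_basis_apply {ι R : Type*} {η F : ι → Type*} [Semiring R]
    [∀ i, AddCommMonoid (F i)] [∀ i, Module R (F i)] (b : ∀ i, Module.Basis (η i) R (F i)) (i : ι)
    (j : η i) : DFinsupp.basis b ⟨i, j⟩ = DFinsupp.single i (b i j) := by
  rw [Module.Basis.apply_eq_iff]
  simp [DFinsupp.basis, Equiv.symm_apply_eq]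

end Auxiliary

/-! ### Local triviality of `S^⊠(E)` -/

section Symmetric

variable {𝕂 : Type v} [RCLike 𝕂] {M : Type u} [TopologicalSpace M] [T2Space M] {d : ℕ}
  [ChartedSpace (EuclideanSpace ℝ (Fin d)) M] {E : Family.{u, v, w} 𝕂 M}

/-- An ordering of `c` extends continuously to orderings of the configurations near `c`. -/
theorem exists_labelling_section {c : UConf M} (p : Labelling c) :
    ∃ L : ∀ c' : UConf M, Labelling c', ∀ᶠ y in 𝓝 p.pt, ∀ h : Function.Injective y,
      L (q y) = ⟨p.card, y, h, rfl⟩ := by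
  obtain ⟨ρ, hρ, hL⟩ := exists_isLabelling c
  have hpc : ∀ i, p.pt i ∈ c := fun i => p.eq.subset (mem_q.2 ⟨i, rfl⟩)
  refine ⟨fun c' => if h : ∃ y : Fin p.card → M, Function.Injective y ∧ q y = c' ∧
    ∀ i, ρ (y i) = p.pt i then ⟨p.card, h.choose, h.choose_spec.1, h.choose_spec.2.1⟩
    else someLabelling c', ?_⟩
  have h1 : ∀ᶠ y in 𝓝 p.pt, ∀ i, ρ (y i) = p.pt i := by
    refine Filter.eventually_all.2 fun i => ?_
    have := hL.self_of_nhds.eventually_eq (p.pt i) (hpc i)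
    rw [hρ _ (hpc i)] at this
    exact (continuous_apply i).continuousAt.eventually this
  filter_upwards [h1] with y hy hinj
  have h : ∃ y' : Fin p.card → M, Function.Injective y' ∧ q y' = q y ∧
    ∀ i, ρ (y' i) = p.pt i := ⟨y, hinj, rfl, hy⟩
  simp only [dif_pos h]
  -- An ordering of `q y` with the prescribed labels is unique, since the labels `p.pt i` are
  -- distinct.
  have key : h.choose = y := by
    funext i
    obtain ⟨j, hj⟩ := mem_q.1 (h.choose_spec.2.1.subset (mem_q.2 ⟨i, rfl⟩))
    have : j = i := p.inj (by rw [← hy, hj, h.choose_spec.2.2])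
    rw [← hj, this]
  congr 1

/-- This removes the lift to `T^⊠(E)` from the notion of smoothness. A generator of `T^⊠(E)`
projects to a product `⊡ a`; conversely such a product lifts along a continuous choice of orderings
near `c`. -/
theorem cauchySym_smoothAt_iff {s : (cauchySym d E).Section} {c : UConf M} :
    (cauchySym d E).SmoothAt s c ↔ GeneratedAt (smoothConf (𝕂 := 𝕂) d)
      {g | ∃ a : E.Section, (∀ x ∈ c, E.SmoothAt a x) ∧ g = boxdotSection E d a} s c := by
  constructor
  · rintro ⟨t, ht, hs⟩
    refine GeneratedAt.congr ?_ hs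
    refine GeneratedAt.map (F' := (cauchySym d E).Fib) isGermRing_smoothConf ht
      (fun c' => (symRel E c').mkQ) ?_
    rintro g ⟨p, a, ha, hg⟩
    have hmem : boxdotSection E d a ∈ {g | ∃ a : E.Section, (∀ x ∈ c, E.SmoothAt a x) ∧
        g = boxdotSection E d a} := by
      refine ⟨a, fun x hx => ?_, rfl⟩
      obtain ⟨i, rfl⟩ := mem_q.1 (p.eq.superset hx)
      exact ha i
    refine (GeneratedAt.of_mem isGermRing_smoothConf hmem c).congr ?_
    have hc : 𝓝 c = Filter.map q (𝓝 p.pt) := by rw [← nhds_q p.inj, p.eq]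
    rw [hc, Filter.eventually_map]
    filter_upwards [hg, eventually_injective p.inj] with y hy hinj
    rw [hy hinj]
    exact boxdot_eq_section E d a _
  · rintro ⟨n, f, g, hf, hg, hs⟩
    choose a ha hga using hg
    obtain ⟨L, hL⟩ := exists_labelling_section (someLabelling c)
    refine ⟨fun c' => ∑ j, f j c' • tens E (a j) (L c'), ⟨n, f, fun j c' => tens E (a j) (L c'), hf,
      fun j => ⟨someLabelling c, a j, fun i => ha j _ ?_, ?_⟩, .of_forall fun _ => rfl⟩, ?_⟩
    · exact (someLabelling c).eq.subset (mem_q.2 ⟨i, rfl⟩)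
    · filter_upwards [hL] with y hy h
      rw [hy h]
    · filter_upwards [hs] with c' hc'
      rw [hc', map_sum]
      refine Finset.sum_congr rfl fun j _ => ?_
      rw [map_smul, hga j]
      exact congrArg _ (boxdot_eq_section E d (a j) (L c')).symm

/-- The bijection of nearby configurations given by a labelling. -/
noncomputable def IsLabelling.equiv {ρ : M → M} {c c' : UConf M} (h : IsLabelling ρ c c') :
    c' ≃ c :=
  Equiv.ofBijective (fun y => ⟨ρ y, h.bijOn.mapsTo y.2⟩)
    ⟨fun y y' e => Subtype.ext (h.bijOn.injOn y.2 y'.2 (congrArg (fun z : c => z.1) e)), fun x => by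
      obtain ⟨y, hy, e⟩ := h.bijOn.surjOn x.2
      exact ⟨⟨y, hy⟩, Subtype.ext e⟩⟩

/-- The frame consists of the products that use, near the point labelled `x`, one member of a frame
attached to `x`. At `c'` these products form the tensor product basis, and multilinear expansion of
`⊡ a` shows that they generate. The labelling must persist near `c'`, because the expansion is an
identity of germs. -/
theorem isFrameAt_cauchySym (hE : IsVectorBundle (smoothFun d) E) {ρ : M → M} {c c' : UConf M}
    (hρ : ∀ᶠ c'' in 𝓝 c', IsLabelling ρ c c'') {ι : c → Type w'} (e : ∀ x, ι x → E.Section)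
    (he : ∀ y : c', IsFrameAt (smoothFun d) E (e (hρ.self_of_nhds.equiv y)) y) :
    IsFrameAt (smoothConf d) (cauchySym d E)
      (fun J : ∀ x : c, ι x => boxdotSection E d (glue ρ e J)) c' := by
  have hρ' := hρ.self_of_nhds
  let b : Module.Basis (∀ x : c, ι x) 𝕂 ((cauchySym d E).Fib c') :=
    ((Basis.piTensorProduct fun y : c' => (he y).basis).reindex
      (Equiv.piCongrLeft (fun x : c => ι x) hρ'.equiv)).map (fibEquiv E d c').symm
  refine .of_basis b (fun J => ?_) fun s => ?_
  · have h1 : (fun y : c' => (he y).basis (J (hρ'.equiv y))) =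
        fun y : c' => glue ρ e J y.1 := funext fun y =>
      ((he y).basis_apply _).trans (glue_apply e J (hρ'.bijOn.mapsTo y.2)).symm
    rw [← fibEquiv_symm_tprod, ← h1, Module.Basis.map_apply, Module.Basis.reindex_apply,
      Basis.piTensorProduct_apply]
    rfl
  rw [cauchySym_smoothAt_iff]
  constructor
  · intro hs
    refine hs.trans isGermRing_smoothConf ?_
    rintro _ ⟨a, ha, rfl⟩
    -- The coefficients are indexed by labels in `c`, not by points of `c'`, so that they can be
    -- evaluated on every configuration near `c'`.
    have h1 : ∀ x : c, ∃ (n : ℕ) (f : Fin n → M → 𝕂) (i : Fin n → ι x),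
        (∀ j, smoothFun d (f j) (hρ'.equiv.symm x)) ∧
        ∀ᶠ z in 𝓝 (hρ'.equiv.symm x : M), a z = ∑ j, f j z • e x (i j) z := by
      intro x
      obtain ⟨y, rfl⟩ := hρ'.equiv.surjective x
      rw [Equiv.symm_apply_apply]
      obtain ⟨n, f, g, hf, hg, h⟩ := ((he y).2.2 a).1 (ha y y.2)
      choose i hi using hg
      refine ⟨n, f, i, hf, ?_⟩
      filter_upwards [h] with z hz
      rw [hz]
      exact Finset.sum_congr rfl fun j _ => by rw [← hi j]
    choose n f i hf h using h1
    -- One term for each choice `K` of a summand at every label, as in the expansion of a product of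
    -- sums.
    refine (GeneratedAt.sum (s := fun (K : ∀ x : c, Fin (n x)) c'' =>
      (∏ y ∈ c'', glue ρ f K y) • boxdotSection E d (glue ρ e fun x => i x (K x)) c'') Finset.univ
      fun K _ => GeneratedAt.smul isGermRing_smoothConf (smoothConf_prod fun y hy => ?_)
        (.of_mem isGermRing_smoothConf (Set.mem_range_self fun x => i x (K x)) _)).congr ?_
    · refine isGermRing_smoothFun.congr ((glue_eventuallyEq hρ' f K hy).mono fun _ e => e.symm) ?_
      have := hf (hρ'.equiv ⟨y, hy⟩) (K _)
      rwa [Equiv.symm_apply_apply] at this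
    have hU : ∀ᶠ c'' : UConf M in 𝓝 c', (c'' : Set M) ⊆ {z | ∀ hz : ρ z ∈ c,
        a z = ∑ j, f ⟨ρ z, hz⟩ j z • e ⟨ρ z, hz⟩ (i ⟨ρ z, hz⟩ j) z} := by
      refine eventually_subset fun y hy => ?_
      have h2 := h (hρ'.equiv ⟨y, hy⟩)
      rw [Equiv.symm_apply_apply] at h2
      filter_upwards [h2, hρ'.eventually_eq y hy] with z hz hρz hzc
      have : (⟨ρ z, hzc⟩ : c) = hρ'.equiv ⟨y, hy⟩ := Subtype.ext hρz
      rw [this]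
      exact hz
    filter_upwards [hU, hρ] with c'' hc hρ''
    apply (fibEquiv E d c'').injective
    have h3 : (fun z : c'' => a z) = fun z : c'' => ∑ j : Fin (n (hρ''.equiv z)),
        f (hρ''.equiv z) j z • e (hρ''.equiv z) (i _ j) z :=
      funext fun z => hc z.2 (hρ''.equiv z).2
    rw [fibEquiv_boxdotSection, map_sum, h3, MultilinearMap.map_sum]
    refine (Fintype.sum_equiv
      (Equiv.piCongrLeft (fun x => Fin (n x)) hρ''.equiv).symm _ _ fun K => ?_).symm
    rw [map_smul, fibEquiv_boxdotSection, ← Finset.prod_coe_sort, ← MultilinearMap.map_smul_univ]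
    refine congrArg _ (funext fun z => ?_)
    rw [glue_apply f K (hρ''.equiv z).2, glue_apply e _ (hρ''.equiv z).2]
    rfl
  · intro hs
    refine hs.mono ?_
    rintro _ ⟨J, rfl⟩
    refine ⟨_, fun y hy => ?_, rfl⟩
    exact hE.smoothAt_congr ((he ⟨y, hy⟩).smooth isGermRing_smoothFun _)
      (glue_eventuallyEq hρ' e J hy)

theorem IsVectorBundle.cauchySym (hE : IsVectorBundle (smoothFun d) E) :
    IsVectorBundle (smoothConf d) (cauchySym d E) := by
  refine isVectorBundle_of_frames fun c => ?_
  choose ι e he using id hE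
  obtain ⟨ρ, hρ, hL⟩ := exists_isLabelling c
  refine ⟨∀ x : c, ι x, fun J => boxdotSection E d (glue ρ (fun x : c => e x) J), ?_⟩
  have h1 : ∀ᶠ c' : UConf M in 𝓝 c,
      (c' : Set M) ⊆ {z | IsFrameAt (smoothFun d) E (e (ρ z)) z} := by
    refine eventually_subset fun y hy => ?_
    filter_upwards [he y, hL.self_of_nhds.eventually_eq y hy] with z hz hρz
    rw [hρz, hρ y hy]
    exact hz
  filter_upwards [eventually_eventually_nhds.2 hL, h1] with c' hc' h
  exact isFrameAt_cauchySym hE hc' (fun x : c => e x) fun y => h y.2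

end Symmetric

/-! ### Local triviality of the Cauchy product -/

section Cauchy

variable {𝕂 : Type v} [RCLike 𝕂] {M : Type u} [TopologicalSpace M] {d : ℕ}
  [ChartedSpace (EuclideanSpace ℝ (Fin d)) M] {V : Family.{u, v, w} 𝕂 (UConf M)}
  {W : Family.{u, v, w'} 𝕂 (UConf M)}

variable (d) in
/-- The section of `V ⊠ W` with the value `a(c') ⊗ b(c'')` in the summand of the split
`c = c' ⊔ c''` along `A`. -/
noncomputable def cauchySection (A : Set M) (a : V.Section) (b : W.Section) :
    (cauchy d V W).Section :=
  fun c => inc V W (splitBy A c) (a (splitBy A c).fst ⊗ₜ[𝕂] b (splitBy A c).snd)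

variable (d) in
/-- The basis of a fibre of `V ⊠ W` obtained from bases of the summands. -/
noncomputable def cauchyBasis {c : UConf M} {η : Split c → Type*}
    (B : ∀ p : Split c, Module.Basis (η p) 𝕂 (V.Fib p.fst ⊗[𝕂] W.Fib p.snd)) :
    Module.Basis (Σ p : Split c, η p) 𝕂 ((cauchy d V W).Fib c) :=
  DFinsupp.basis B

theorem cauchyBasis_apply {c : UConf M} {η : Split c → Type*}
    (B : ∀ p : Split c, Module.Basis (η p) 𝕂 (V.Fib p.fst ⊗[𝕂] W.Fib p.snd)) (p : Split c)
    (j : η p) : cauchyBasis d B ⟨p, j⟩ = inc V W p (B p j) :=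
  (dfinsupp_basis_apply B p j).trans rfl

variable [T2Space M]

theorem eventuallyEq_cauchySection {A : Set M} {c : UConf M} (hA : Cuts A c) {a : V.Section}
    {b : W.Section} {g : (cauchy d V W).Section}
    (hg : ∀ᶠ r : UConf M × UConf M in 𝓝 ((splitBy A c).fst, (splitBy A c).snd),
      ∀ h : Disjoint r.1 r.2, g (r.1 ∪ r.2) = inc V W ⟨r.1, r.2, h, rfl⟩ (a r.1 ⊗ₜ[𝕂] b r.2)) :
    ∀ᶠ c' in 𝓝 c, g c' = cauchySection d A a b c' := by
  filter_upwards [(tendsto_splitBy hA).eventually hg] with c' h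
  -- Quantifying over the split allows the equation `s.fst ∪ s.snd = c'` to be eliminated by
  -- substitution.
  have : ∀ s : Split c', g (s.fst ∪ s.snd) = inc V W ⟨s.fst, s.snd, s.disj, rfl⟩
      (a s.fst ⊗ₜ[𝕂] b s.snd) → g c' = inc V W s (a s.fst ⊗ₜ[𝕂] b s.snd) := by
    rintro ⟨c₁, c₂, hd, rfl⟩ h
    exact h
  exact this _ (h (splitBy A c').disj)

theorem cauchySection_mem {A : Set M} {c : UConf M} (hA : Cuts A c) (a : V.Section)
    (b : W.Section) :
    ∀ᶠ r : UConf M × UConf M in 𝓝 ((splitBy A c).fst, (splitBy A c).snd),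
      ∀ h : Disjoint r.1 r.2, cauchySection d A a b (r.1 ∪ r.2) =
        inc V W ⟨r.1, r.2, h, rfl⟩ (a r.1 ⊗ₜ[𝕂] b r.2) := by
  have h1 : ∀ᶠ c' : UConf M in 𝓝 (splitBy A c).fst, (c' : Set M) ⊆ A :=
    eventually_subset fun x hx => (hA x (mem_part.1 hx).1).resolve_right fun h =>
      mem_of_mem_nhds h (mem_part.1 hx).2
  have h2 : ∀ᶠ c' : UConf M in 𝓝 (splitBy A c).snd, (c' : Set M) ⊆ Aᶜ :=
    eventually_subset fun x hx => (hA x (mem_part.1 hx).1).resolve_left fun h =>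
      (mem_part.1 hx).2 (mem_of_mem_nhds h)
  filter_upwards [h1.prod_nhds h2] with r hr h
  rw [cauchySection, splitBy_union hr.1 hr.2 h]

/-- The generators become globally defined sections: a split of `c` is realised by a cut `A`, and
the germ prescribed in `cauchy` is that of the section supported on the splits along `A`. -/
theorem cauchy_smoothAt_iff {s : (cauchy d V W).Section} {c : UConf M} :
    (cauchy d V W).SmoothAt s c ↔ GeneratedAt (smoothConf (𝕂 := 𝕂) d)
      {g | ∃ (A : Set M) (a : V.Section) (b : W.Section), Cuts A c ∧
        V.SmoothAt a (splitBy A c).fst ∧ W.SmoothAt b (splitBy A c).snd ∧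
        g = cauchySection d A a b} s c := by
  constructor
  · intro hs
    refine GeneratedAt.trans isGermRing_smoothConf hs ?_
    rintro g ⟨p, a, b, ha, hb, hg⟩
    obtain ⟨A, hA, rfl⟩ := exists_cuts p
    exact (GeneratedAt.of_mem isGermRing_smoothConf (Set.mem_ofPred.2 ⟨A, a, b, hA, ha, hb, rfl⟩)
      c).congr (eventuallyEq_cauchySection hA hg)
  · intro hs
    refine GeneratedAt.mono hs ?_
    rintro _ ⟨A, a, b, hA, ha, hb, rfl⟩
    exact ⟨splitBy A c, a, b, ha, hb, cauchySection_mem hA a b⟩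

/-- If `a` and `b` are generated by `G` and `G'`, then `a ⊗ b` is generated by the products. -/
theorem generatedAt_cauchySection {A : Set M} {c : UConf M} (hA : Cuts A c)
    {F : UConf M → Type*} [∀ x, AddCommGroup (F x)] [∀ x, Module 𝕂 (F x)]
    {G : Set V.Section} {G' : Set W.Section} {G'' : Set (∀ c, F c)} {a : V.Section}
    {b : W.Section} (ha : GeneratedAt (smoothConf (𝕂 := 𝕂) d) G a (splitBy A c).fst)
    (hb : GeneratedAt (smoothConf (𝕂 := 𝕂) d) G' b (splitBy A c).snd)
    (φ : ∀ c, (cauchy d V W).Fib c →ₗ[𝕂] F c)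
    (h : ∀ g ∈ G, ∀ g' ∈ G', GeneratedAt (smoothConf (𝕂 := 𝕂) d) G''
      (fun c' => φ c' (cauchySection d A g g' c')) c) :
    GeneratedAt (smoothConf (𝕂 := 𝕂) d) G'' (fun c' => φ c' (cauchySection d A a b c')) c := by
  obtain ⟨m, f, g, hf, hg, e⟩ := ha
  obtain ⟨n, f', g', hf', hg', e'⟩ := hb
  refine (GeneratedAt.sum (s := fun i c' => ∑ j, f i (splitBy A c').fst •
    f' j (splitBy A c').snd • φ c' (cauchySection d A (g i) (g' j) c')) Finset.univ
    fun i _ => GeneratedAt.sum (s := fun j c' => f i (splitBy A c').fst •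
    f' j (splitBy A c').snd • φ c' (cauchySection d A (g i) (g' j) c')) Finset.univ
    fun j _ => ((h _ (hg i) _ (hg' j)).smul isGermRing_smoothConf
      (smoothConf_filter hA.compl (hf' j))).smul isGermRing_smoothConf
      (smoothConf_filter hA (hf i))).congr ?_
  filter_upwards [(tendsto_splitBy hA).eventually (e.prod_nhds e')] with c' hc'
  rw [cauchySection, hc'.1, hc'.2, TensorProduct.sum_tmul, map_sum, map_sum]
  refine Finset.sum_congr rfl fun i _ => ?_
  rw [TensorProduct.tmul_sum, map_sum, map_sum]
  refine Finset.sum_congr rfl fun j _ => ?_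
  rw [TensorProduct.smul_tmul_smul, map_smul, map_smul, mul_smul]
  rfl

/-- The splits of `c'` are those of `c`, so the tensor products of frames for the individual splits
together form a basis of the direct sum. A cut enters only through the split of `c'` that it
induces, so every generator can be rewritten with a cut of the form `ρ ⁻¹' p.fst`. -/
theorem isFrameAt_cauchy {ρ : M → M} {c c' : UConf M} (hρ : IsLabelling ρ c c')
    {ι : Split c → Type*} {κ : Split c → Type*} (e : ∀ p, ι p → V.Section)
    (e' : ∀ p, κ p → W.Section)
    (he : ∀ p : Split c, IsFrameAt (smoothConf d) V (e p) (splitBy (ρ ⁻¹' (p.fst : Set M)) c').fst)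
    (he' : ∀ p : Split c,
      IsFrameAt (smoothConf d) W (e' p) (splitBy (ρ ⁻¹' (p.fst : Set M)) c').snd) :
    IsFrameAt (smoothConf d) (cauchy d V W) (fun j : Σ p : Split c, ι p × κ p =>
      cauchySection d (ρ ⁻¹' (j.1.fst : Set M)) (e j.1 j.2.1) (e' j.1 j.2.2)) c' := by
  obtain ⟨σ, hσ⟩ : ∃ σ : Split c ≃ Split c', ∀ p, σ p = splitBy (ρ ⁻¹' (p.fst : Set M)) c' :=
    ⟨Equiv.ofBijective _ hρ.splitBy_bijective, fun _ => rfl⟩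
  have h : ∀ p', IsFrameAt (smoothConf d) V (e (σ.symm p')) p'.fst := by
    intro p'
    obtain ⟨p, rfl⟩ := σ.surjective p'
    rw [Equiv.symm_apply_apply]
    rw [hσ]
    exact he p
  have h' : ∀ p', IsFrameAt (smoothConf d) W (e' (σ.symm p')) p'.snd := by
    intro p'
    obtain ⟨p, rfl⟩ := σ.surjective p'
    rw [Equiv.symm_apply_apply]
    rw [hσ]
    exact he' p
  choose B hB using fun p' => (h p').exists_basis_tmul (h' p')
  refine .of_basis ((cauchyBasis d B).reindex
    (Equiv.sigmaCongrLeft (β := fun p => ι p × κ p) σ.symm)) (fun j => ?_) fun s => ?_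
  · obtain ⟨⟨p', j⟩, rfl⟩ := (Equiv.sigmaCongrLeft (β := fun p => ι p × κ p) σ.symm).surjective j
    rw [Module.Basis.reindex_apply, Equiv.symm_apply_apply]
    refine (cauchyBasis_apply B p' j).trans ?_
    rw [hB]
    have h2 : ∀ s : Split c', s = p' → inc V W p' (e (σ.symm p') j.1 p'.fst ⊗ₜ[𝕂]
        e' (σ.symm p') j.2 p'.snd) =
          inc V W s (e (σ.symm p') j.1 s.fst ⊗ₜ[𝕂] e' (σ.symm p') j.2 s.snd) := by
      rintro _ rfl
      rfl
    refine h2 _ ?_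
    exact (hσ _).symm.trans (σ.apply_symm_apply p')
  rw [cauchy_smoothAt_iff]
  constructor
  · intro hs
    refine hs.trans isGermRing_smoothConf ?_
    rintro _ ⟨A, a, b, hA, ha, hb, rfl⟩
    -- The cuts along `A` and along the preimage of `p.fst` agree at `c'`, hence define the same
    -- germ there.
    obtain ⟨p, hp⟩ := σ.surjective (splitBy A c')
    have hp' : splitBy (ρ ⁻¹' (p.fst : Set M)) c' = splitBy A c' := (hσ p).symm.trans hp
    have hcut := hρ.cuts (p.fst : Set M)
    have hg := cauchySection_mem (d := d) hA a b
    rw [← hp'] at ha hb hg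
    refine GeneratedAt.congr ?_ (eventuallyEq_cauchySection hcut hg)
    refine generatedAt_cauchySection hcut (((he p).2.2 a).1 ha) (((he' p).2.2 b).1 hb)
      (fun _ => LinearMap.id) ?_
    rintro _ ⟨i, rfl⟩ _ ⟨j, rfl⟩
    exact .of_mem isGermRing_smoothConf
      (Set.mem_range_self (⟨p, i, j⟩ : Σ p : Split c, ι p × κ p)) _
  · intro hs
    refine hs.mono ?_
    rintro _ ⟨j, rfl⟩
    exact ⟨_, _, _, hρ.cuts _, (he j.1).smooth isGermRing_smoothConf _,
      (he' j.1).smooth isGermRing_smoothConf _, rfl⟩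

theorem IsVectorBundle.cauchy (hV : IsVectorBundle (smoothConf d) V)
    (hW : IsVectorBundle (smoothConf d) W) : IsVectorBundle (smoothConf d) (cauchy d V W) := by
  refine isVectorBundle_of_frames fun c => ?_
  choose ι e he using hV
  choose κ e' he' using hW
  obtain ⟨ρ, hρ, hL⟩ := exists_isLabelling c
  refine ⟨Σ p : Split c, ι p.fst × κ p.snd, fun j => cauchySection d (ρ ⁻¹' (j.1.fst : Set M))
    (e _ j.2.1) (e' _ j.2.2), ?_⟩
  have h1 : ∀ᶠ c' in 𝓝 c, ∀ p : Split c,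
      IsFrameAt (smoothConf d) V (e p.fst) (splitBy (ρ ⁻¹' (p.fst : Set M)) c').fst ∧
      IsFrameAt (smoothConf d) W (e' p.snd) (splitBy (ρ ⁻¹' (p.fst : Set M)) c').snd := by
    refine Filter.eventually_all.2 fun p => ?_
    have h2 := tendsto_splitBy (hL.self_of_nhds.cuts (p.fst : Set M))
    rw [splitBy_self hρ p] at h2
    exact h2.eventually ((he p.fst).prod_nhds (he' p.snd))
  filter_upwards [hL, h1] with c' hc' h
  exact isFrameAt_cauchy hc' (fun p => e p.fst) (fun p => e' p.snd) (fun p => (h p).1)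
    fun p => (h p).2

end Cauchy

/-! ### Structure maps on decomposable elements -/

section Evaluation

variable {𝕂 : Type v} [RCLike 𝕂] {M : Type u} [TopologicalSpace M] {d : ℕ}
  [ChartedSpace (EuclideanSpace ℝ (Fin d)) M]

universe w₁ w₂ w₃ w₄

variable {V : Family.{u, v, w₁} 𝕂 (UConf M)} {W : Family.{u, v, w₂} 𝕂 (UConf M)}
  {V' : Family.{u, v, w₃} 𝕂 (UConf M)} {W' : Family.{u, v, w₄} 𝕂 (UConf M)} {c : UConf M}

theorem cauchyMap_inc (f : ∀ c, V.Fib c →ₗ[𝕂] V'.Fib c) (g : ∀ c, W.Fib c →ₗ[𝕂] W'.Fib c)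
    (p : Split c) (x : V.Fib p.fst) (y : W.Fib p.snd) :
    cauchyMap d f g c (inc V W p (x ⊗ₜ[𝕂] y)) = inc V' W' p (f p.fst x ⊗ₜ[𝕂] g p.snd y) := by
  rw [cauchyMap, inc, DirectSum.toModule_lof]
  rfl

theorem braidC_inc (p : Split c) (x : V.Fib p.fst) (y : W.Fib p.snd) :
    braidC d V W c (inc V W p (x ⊗ₜ[𝕂] y)) = inc W V
      ⟨p.snd, p.fst, p.disj.symm, (Finset.union_comm _ _).trans p.union⟩ (y ⊗ₜ[𝕂] x) := by
  rw [braidC, inc, DirectSum.toModule_lof]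
  rfl

theorem shuffle_inc (p : Split c) (x : V.Fib p.fst) (y : W.Fib p.fst) (x' : V'.Fib p.snd)
    (y' : W'.Fib p.snd) : shuffle d V W V' W' c (inc (hadamard (smoothConf d) V W)
      (hadamard (smoothConf d) V' W') p ((x ⊗ₜ[𝕂] y) ⊗ₜ[𝕂] (x' ⊗ₜ[𝕂] y'))) =
      inc V V' p (x ⊗ₜ[𝕂] x') ⊗ₜ[𝕂] inc W W' p (y ⊗ₜ[𝕂] y') := by
  rw [shuffle, inc, DirectSum.toModule_lof]
  rfl

theorem assocC_inc (p : Split c) (r : Split p.fst) (h : Disjoint r.snd p.snd)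
    (h' : Disjoint r.fst (r.snd ∪ p.snd)) (hu : r.fst ∪ (r.snd ∪ p.snd) = c) (x : V.Fib r.fst)
    (y : W.Fib r.snd) (z : V'.Fib p.snd) :
    assocC d V W V' c (inc (cauchy d V W) V' p (inc V W r (x ⊗ₜ[𝕂] y) ⊗ₜ[𝕂] z)) =
      inc V (cauchy d W V') ⟨r.fst, r.snd ∪ p.snd, h', hu⟩
        (x ⊗ₜ[𝕂] inc W V' ⟨r.snd, p.snd, h, rfl⟩ (y ⊗ₜ[𝕂] z)) := by
  rw [assocC, inc, DirectSum.toModule_lof, TensorProduct.lift.tmul, inc, DirectSum.toModule_lof]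
  rfl

theorem mu_inc (p : Split c) (r r' : 𝕂) :
    mu (𝕂 := 𝕂) d c (inc (unitH d) (unitH d) p (r ⊗ₜ[𝕂] r')) = r * r' := by
  rw [mu, inc, DirectSum.toModule_lof]
  rfl

theorem nu_oneC : nu (𝕂 := 𝕂) (M := M) d ∅ (oneC 𝕂 ∅) = (1 : 𝕂) := by
  change (oneC 𝕂 (∅ : UConf M) : 𝕂) = 1
  rw [oneC, dif_pos rfl]

/-- Over `∅` the generator has value `1`, and over any other configuration `x` vanishes. This is the
scalar content of `m_⊗ ∘ (u_⊠ ⊗ u_⊠) ∘ Δ = u_⊠`. -/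
theorem nu_smul_oneC (x : unitCFib 𝕂 c) : nu (𝕂 := 𝕂) (M := M) d c x *
    (nu (𝕂 := 𝕂) (M := M) d c (oneC 𝕂 c) * nu (𝕂 := 𝕂) (M := M) d c (oneC 𝕂 c)) =
      nu (𝕂 := 𝕂) (M := M) d c x := by
  change (x : 𝕂) * ((oneC 𝕂 c : 𝕂) * (oneC 𝕂 c : 𝕂)) = (x : 𝕂)
  by_cases h : c = ∅
  · rw [oneC, dif_pos h, one_mul, mul_one]
  · have : (x : 𝕂) = 0 := by
      have hx : (x : 𝕂) ∈ unitCFib 𝕂 c := x.2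
      simp only [unitCFib, if_neg h] at hx
      exact (Submodule.mem_bot 𝕂).1 hx
    rw [this, zero_mul]

theorem leftUnitC_apply (x : V.Fib c) : leftUnitC d V c x = inc (unitC d) V
    ⟨∅, c, Finset.disjoint_empty_left c, Finset.empty_union c⟩ (oneC 𝕂 ∅ ⊗ₜ[𝕂] x) := rfl

theorem rightUnitC_apply (x : V.Fib c) : rightUnitC d V c x = inc V (unitC d)
    ⟨c, ∅, Finset.disjoint_empty_right c, Finset.union_empty c⟩ (x ⊗ₜ[𝕂] oneC 𝕂 ∅) := rfl

theorem delta_apply (x : unitCFib 𝕂 c) : delta (𝕂 := 𝕂) (M := M) d c x =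
    nu (𝕂 := 𝕂) (M := M) d c x • (oneC 𝕂 c ⊗ₜ[𝕂] oneC 𝕂 c) := rfl

end Evaluation

/-! ### Verification of the 2-algebra axioms on generating sections -/

section Presentation

variable {𝕂 : Type v} [RCLike 𝕂] {M : Type u}

/-- Sections of `A`, indexed by a set `S`, whose values span the fibres, and which may be prescribed
independently over disjoint configurations. -/
structure Presentation (A : Family.{u, v, w} 𝕂 (UConf M)) (S : Type*) where
  /-- the section with a given index -/
  box : S → A.Section
  span : ∀ c, Submodule.span 𝕂 (Set.range fun a => box a c) = ⊤
  glue : ∀ {c₁ c₂ : UConf M}, Disjoint c₁ c₂ → ∀ a b, ∃ e,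
    (∀ c ⊆ c₁, box e c = box a c) ∧ ∀ c ⊆ c₂, box e c = box b c

namespace Presentation

variable {A : Family.{u, v, w} 𝕂 (UConf M)} {S : Type*} (P : Presentation A S)

section Ext

variable {N : Type*} [AddCommMonoid N] [Module 𝕂 N] {c : UConf M}

theorem ext {f g : A.Fib c →ₗ[𝕂] N} (H : ∀ a, f (P.box a c) = g (P.box a c)) : f = g :=
  LinearMap.ext_on_range (P.span c) H

/-- Values of two different sections over disjoint configurations are values of one glued section,
so testing on the diagonal suffices. -/
theorem ext₂ {c₁ c₂ : UConf M} (h : Disjoint c₁ c₂) {f g : A.Fib c₁ →ₗ[𝕂] A.Fib c₂ →ₗ[𝕂] N}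
    (H : ∀ a, f (P.box a c₁) (P.box a c₂) = g (P.box a c₁) (P.box a c₂)) : f = g := by
  refine P.ext fun a => P.ext fun b => ?_
  obtain ⟨e, h1, h2⟩ := P.glue h a b
  rw [← h1 _ subset_rfl, ← h2 _ subset_rfl, H]

theorem ext₃ {c₁ c₂ c₃ : UConf M} (h : Disjoint c₁ c₂) (h' : Disjoint (c₁ ∪ c₂) c₃)
    {f g : A.Fib c₁ →ₗ[𝕂] A.Fib c₂ →ₗ[𝕂] A.Fib c₃ →ₗ[𝕂] N}
    (H : ∀ a, f (P.box a c₁) (P.box a c₂) (P.box a c₃) =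
      g (P.box a c₁) (P.box a c₂) (P.box a c₃)) : f = g := by
  refine P.ext₂ h fun a => P.ext fun b => ?_
  obtain ⟨e, h1, h2⟩ := P.glue h' a b
  rw [← h1 _ Finset.subset_union_left, ← h1 _ Finset.subset_union_right, ← h2 _ subset_rfl, H]

variable [TopologicalSpace M] {d : ℕ} [ChartedSpace (EuclideanSpace ℝ (Fin d)) M]

theorem cauchy_ext {f g : (cauchy d A A).Fib c →ₗ[𝕂] N} (H : ∀ (s : Split c) (a : S),
    f (inc A A s (P.box a s.fst ⊗ₜ[𝕂] P.box a s.snd)) =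
      g (inc A A s (P.box a s.fst ⊗ₜ[𝕂] P.box a s.snd))) : f = g :=
  DirectSum.linearMap_ext 𝕂 fun s => TensorProduct.ext (P.ext₂ s.disj fun a => H s a)

theorem cauchy_cauchy_ext {f g : (cauchy d (cauchy d A A) A).Fib c →ₗ[𝕂] N}
    (H : ∀ (s : Split c) (r : Split s.fst) (a : S),
      f (inc (cauchy d A A) A s
        (inc A A r (P.box a r.fst ⊗ₜ[𝕂] P.box a r.snd) ⊗ₜ[𝕂] P.box a s.snd)) =
      g (inc (cauchy d A A) A s
        (inc A A r (P.box a r.fst ⊗ₜ[𝕂] P.box a r.snd) ⊗ₜ[𝕂] P.box a s.snd))) : f = g :=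
  DirectSum.linearMap_ext 𝕂 fun s => TensorProduct.ext <| DirectSum.linearMap_ext 𝕂 fun r =>
    TensorProduct.ext <| P.ext₃ r.disj (by rw [r.union]; exact s.disj) fun a => H s r a

/-- The two Hadamard factors are glued separately. Two independent sections remain, since both
factors live over the same configuration. -/
theorem cauchy_hadamard_ext {f g : (cauchy d (hadamard (smoothConf d) A A)
      (hadamard (smoothConf d) A A)).Fib c →ₗ[𝕂] N}
    (H : ∀ (s : Split c) (a b : S),
      f (inc (hadamard (smoothConf d) A A) (hadamard (smoothConf d) A A) s
        ((P.box a s.fst ⊗ₜ[𝕂] P.box b s.fst) ⊗ₜ[𝕂] (P.box a s.snd ⊗ₜ[𝕂] P.box b s.snd))) =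
      g (inc (hadamard (smoothConf d) A A) (hadamard (smoothConf d) A A) s
        ((P.box a s.fst ⊗ₜ[𝕂] P.box b s.fst) ⊗ₜ[𝕂] (P.box a s.snd ⊗ₜ[𝕂] P.box b s.snd)))) :
    f = g := by
  refine DirectSum.linearMap_ext 𝕂 fun s => TensorProduct.ext <| TensorProduct.ext <|
    P.ext fun a => P.ext fun b => TensorProduct.ext <| P.ext fun a' => P.ext fun b' => ?_
  obtain ⟨α, h1, h2⟩ := P.glue s.disj a a'
  obtain ⟨β, h3, h4⟩ := P.glue s.disj b b'
  rw [← h1 _ subset_rfl, ← h2 _ subset_rfl, ← h3 _ subset_rfl, ← h4 _ subset_rfl]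
  exact H s α β

end Ext

section CauchyIdentities

variable [TopologicalSpace M] {d : ℕ} [ChartedSpace (EuclideanSpace ℝ (Fin d)) M]
  {mC : ∀ c, (cauchy d A A).Fib c →ₗ[𝕂] A.Fib c}

/-- By `hC`, multiplying the values of one section over a threefold split gives its value over `c`,
whichever pair is multiplied first. -/
theorem mulC_assoc (hC : ∀ {c} (s : Split c) a,
      mC c (inc A A s (P.box a s.fst ⊗ₜ[𝕂] P.box a s.snd)) = P.box a c)
    (c : UConf M) : mC c ∘ₗ cauchyMap d mC (fun _ => LinearMap.id) c =
    mC c ∘ₗ cauchyMap d (fun _ => LinearMap.id) mC c ∘ₗ assocC d A A A c := by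
  refine P.cauchy_cauchy_ext fun s r a => ?_
  have hd : Disjoint r.fst s.snd ∧ Disjoint r.snd s.snd :=
    Finset.disjoint_union_left.1 (by rw [r.union]; exact s.disj)
  have hd' : Disjoint r.fst (r.snd ∪ s.snd) := Finset.disjoint_union_right.2 ⟨r.disj, hd.1⟩
  have hu : r.fst ∪ (r.snd ∪ s.snd) = c := by rw [← Finset.union_assoc, r.union, s.union]
  have h1 := hC ⟨r.snd, s.snd, hd.2, rfl⟩ a
  have h2 := hC ⟨r.fst, r.snd ∪ s.snd, hd', hu⟩ a
  rw [LinearMap.comp_apply, LinearMap.comp_apply, LinearMap.comp_apply, cauchyMap_inc,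
    assocC_inc s r hd.2 hd' hu, cauchyMap_inc, hC, LinearMap.id_apply, LinearMap.id_apply, hC]
  exact h2.symm.trans (by rw [h1])

theorem mulC_comm (hC : ∀ {c} (s : Split c) a,
      mC c (inc A A s (P.box a s.fst ⊗ₜ[𝕂] P.box a s.snd)) = P.box a c)
    (c : UConf M) : mC c ∘ₗ braidC d A A c = mC c := by
  refine P.cauchy_ext fun s a => ?_
  rw [LinearMap.comp_apply, hC, braidC_inc]
  exact hC ⟨s.snd, s.fst, s.disj.symm, (Finset.union_comm _ _).trans s.union⟩ a

end CauchyIdentities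

section HadamardIdentities

variable [CommMonoid S] {mH : ∀ c, A.Fib c ⊗[𝕂] A.Fib c →ₗ[𝕂] A.Fib c}

theorem mulH_assoc (hH : ∀ c a b, mH c (P.box a c ⊗ₜ[𝕂] P.box b c) = P.box (a * b) c)
    (c : UConf M) : mH c ∘ₗ TensorProduct.map (mH c) LinearMap.id =
    mH c ∘ₗ TensorProduct.map LinearMap.id (mH c) ∘ₗ
      (TensorProduct.assoc 𝕂 (A.Fib c) (A.Fib c) (A.Fib c)).toLinearMap := by
  refine TensorProduct.ext <| TensorProduct.ext <| P.ext fun a => P.ext fun b => P.ext fun e => ?_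
  change mH c (mH c (P.box a c ⊗ₜ P.box b c) ⊗ₜ P.box e c) =
    mH c (P.box a c ⊗ₜ mH c (P.box b c ⊗ₜ P.box e c))
  rw [hH, hH, hH, hH, mul_assoc]

theorem mulH_comm (hH : ∀ c a b, mH c (P.box a c ⊗ₜ[𝕂] P.box b c) = P.box (a * b) c)
    (c : UConf M) :
    mH c ∘ₗ (TensorProduct.comm 𝕂 (A.Fib c) (A.Fib c)).toLinearMap = mH c := by
  refine TensorProduct.ext <| P.ext fun a => P.ext fun b => ?_
  change mH c (_ ⊗ₜ _) = mH c (_ ⊗ₜ _)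
  rw [hH, hH, mul_comm]

theorem one_mulH (hH : ∀ c a b, mH c (P.box a c ⊗ₜ[𝕂] P.box b c) = P.box (a * b) c)
    (c : UConf M) (r : 𝕂) (x : A.Fib c) :
    mH c ((r • P.box 1 c) ⊗ₜ[𝕂] x) = r • x := by
  have : TensorProduct.curry (mH c) (P.box 1 c) = LinearMap.id := P.ext fun a => by
    rw [TensorProduct.curry_apply, hH, one_mul]; rfl
  rw [← TensorProduct.smul_tmul', map_smul]
  exact congrArg (r • ·) (LinearMap.congr_fun this x)

variable [TopologicalSpace M] {d : ℕ} [ChartedSpace (EuclideanSpace ℝ (Fin d)) M]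
  {mC : ∀ c, (cauchy d A A).Fib c →ₗ[𝕂] A.Fib c}

/-- Both sides send the generator given by `a` and `b` to the value of `a * b` over `c`: restriction
to the parts of a split is compatible with pointwise products. -/
theorem interchange (hC : ∀ {c} (s : Split c) a,
      mC c (inc A A s (P.box a s.fst ⊗ₜ[𝕂] P.box a s.snd)) = P.box a c)
    (hH : ∀ c a b, mH c (P.box a c ⊗ₜ[𝕂] P.box b c) = P.box (a * b) c)
    (c : UConf M) :
    mH c ∘ₗ TensorProduct.map (mC c) (mC c) ∘ₗ shuffle d A A A A c =
      mC c ∘ₗ cauchyMap d (V := hadamard (smoothConf d) A A) (W := hadamard (smoothConf d) A A)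
        mH mH c := by
  refine P.cauchy_hadamard_ext fun s a b => ?_
  rw [LinearMap.comp_apply, LinearMap.comp_apply, LinearMap.comp_apply, shuffle_inc, cauchyMap_inc,
    TensorProduct.map_tmul, hH, hH, hC, hC, hC, hH]

variable {uH : ∀ c, 𝕂 →ₗ[𝕂] A.Fib c}

theorem mulC_one (hC : ∀ {c} (s : Split c) a,
      mC c (inc A A s (P.box a s.fst ⊗ₜ[𝕂] P.box a s.snd)) = P.box a c)
    (hu : ∀ c (r : 𝕂), uH c r = r • P.box 1 c)
    (c : UConf M) :
    mC c ∘ₗ cauchyMap d (V := unitH d) (W := unitH d) uH uH c = uH c ∘ₗ mu d c := by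
  refine DirectSum.linearMap_ext 𝕂 fun s => TensorProduct.ext' fun r r' => ?_
  have h1 := cauchyMap_inc (d := d) (V := unitH d) (W := unitH d) (V' := A) (W' := A) uH uH s r r'
  have h2 := mu_inc (𝕂 := 𝕂) (d := d) s r r'
  refine (congrArg (mC c) h1).trans (Eq.trans ?_ (congrArg (uH c) h2).symm)
  rw [hu, hu, hu, TensorProduct.smul_tmul_smul, map_smul, map_smul, hC]

theorem un_oneC (hu : ∀ c (r : 𝕂), uH c r = r • P.box 1 c) :
    uH ∅ (nu (𝕂 := 𝕂) (M := M) d ∅ (oneC 𝕂 ∅)) = P.box 1 ∅ := by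
  rw [nu_oneC, hu, one_smul]

/-- Over `∅` all the sections have the same value, by `hbox`. The unit can therefore be read as the
value of the given section `a` itself, and `hC` applies to the split `c = ∅ ⊔ c`. -/
theorem mulC_leftUnit (hC : ∀ {c} (s : Split c) a,
      mC c (inc A A s (P.box a s.fst ⊗ₜ[𝕂] P.box a s.snd)) = P.box a c)
    (hu : ∀ c (r : 𝕂), uH c r = r • P.box 1 c)
    (hbox : ∀ a b, P.box a ∅ = P.box b ∅)
    (c : UConf M) : mC c ∘ₗ cauchyMap d (V := unitC d) (W := A)
    (fun c => uH c ∘ₗ nu d c) (fun _ => LinearMap.id) c ∘ₗ leftUnitC d A c = LinearMap.id := by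
  refine P.ext fun a => ?_
  rw [LinearMap.comp_apply, LinearMap.comp_apply, leftUnitC_apply, cauchyMap_inc,
    LinearMap.comp_apply, P.un_oneC hu, hbox 1 a]
  exact hC ⟨∅, c, Finset.disjoint_empty_left c, Finset.empty_union c⟩ a

theorem mulC_rightUnit (hC : ∀ {c} (s : Split c) a,
      mC c (inc A A s (P.box a s.fst ⊗ₜ[𝕂] P.box a s.snd)) = P.box a c)
    (hu : ∀ c (r : 𝕂), uH c r = r • P.box 1 c)
    (hbox : ∀ a b, P.box a ∅ = P.box b ∅)
    (c : UConf M) : mC c ∘ₗ cauchyMap d (V := A) (W := unitC d)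
    (fun _ => LinearMap.id) (fun c => uH c ∘ₗ nu d c) c ∘ₗ rightUnitC d A c = LinearMap.id := by
  refine P.ext fun a => ?_
  rw [LinearMap.comp_apply, LinearMap.comp_apply, rightUnitC_apply, cauchyMap_inc,
    LinearMap.comp_apply, P.un_oneC hu, hbox 1 a]
  exact hC ⟨c, ∅, Finset.disjoint_empty_right c, Finset.union_empty c⟩ a

theorem mulH_un (hH : ∀ c a b, mH c (P.box a c ⊗ₜ[𝕂] P.box b c) = P.box (a * b) c)
    (hu : ∀ c (r : 𝕂), uH c r = r • P.box 1 c)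
    (c : UConf M) :
    mH c ∘ₗ TensorProduct.map (uH c ∘ₗ nu d c) (uH c ∘ₗ nu d c) ∘ₗ delta d c =
      uH c ∘ₗ nu d c := by
  refine LinearMap.ext fun x => ?_
  rw [LinearMap.comp_apply, LinearMap.comp_apply, delta_apply, map_smul, map_smul,
    TensorProduct.map_tmul, LinearMap.comp_apply, LinearMap.comp_apply, hu, hu, P.one_mulH hH,
    smul_smul, smul_smul]
  exact congrArg (· • P.box 1 c) ((mul_assoc _ _ _).trans (nu_smul_oneC x))

end HadamardIdentities

/-- The 2-algebra bundle given by operations with the expected values on a presentation. -/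
noncomputable def twoAlgebra [CommMonoid S] [TopologicalSpace M] {d : ℕ}
    [ChartedSpace (EuclideanSpace ℝ (Fin d)) M] (hA : IsVectorBundle (smoothConf d) A)
    (mC : BundleMap (cauchy d A A) A) (mH : BundleMap (hadamard (smoothConf d) A A) A)
    (uH : BundleMap (unitH (𝕂 := 𝕂) (M := M) d) A)
    (hC : ∀ {c} (s : Split c) a,
      mC.toFun c (inc A A s (P.box a s.fst ⊗ₜ[𝕂] P.box a s.snd)) = P.box a c)
    (hH : ∀ c a b, mH.toFun c (P.box a c ⊗ₜ[𝕂] P.box b c) = P.box (a * b) c)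
    (hu : ∀ c (r : 𝕂), uH.toFun c r = r • P.box 1 c)
    (hbox : ∀ a b, P.box a ∅ = P.box b ∅) : TwoAlgebra d A where
  isVectorBundle := hA
  mulH := mH
  oneH := uH
  mulC := mC
  -- The axiom `u_⊗ ∘ ν = u_⊠` leaves no other choice. Smoothness is inherited, as a section of
  -- `I_⊠` is smooth exactly if it is smooth as a scalar function.
  unC := ⟨fun c => uH.toFun c ∘ₗ nu d c, fun s c hs => uH.smooth (fun c' => (s c' : 𝕂)) c hs⟩
  mulH_assoc := P.mulH_assoc hH
  oneH_mulH c := TensorProduct.ext' fun r x => by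
    rw [LinearMap.comp_apply, TensorProduct.map_tmul, hu, P.one_mulH hH]
    rfl
  mulH_oneH c := TensorProduct.ext' fun x r => by
    rw [← P.mulH_comm hH, LinearMap.comp_apply, TensorProduct.map_tmul, hu]
    exact P.one_mulH hH c r x
  mulC_assoc := P.mulC_assoc hC
  unC_mulC := P.mulC_leftUnit hC hu hbox
  mulC_unC := P.mulC_rightUnit hC hu hbox
  interchange := P.interchange hC hH
  mulC_oneH := P.mulC_one hC hu
  mulH_unC := P.mulH_un hH hu
  oneH_nu _ := rfl

end Presentation

end Presentation

/-! ### Smoothness of the operations -/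

section Maps

variable {𝕂 : Type v} [RCLike 𝕂] {M : Type u} [TopologicalSpace M] [T2Space M] {d : ℕ}
  [ChartedSpace (EuclideanSpace ℝ (Fin d)) M]

theorem generatedAt_boxdotSection {E : Family.{u, v, w} 𝕂 M} {a : E.Section} {c : UConf M}
    (ha : ∀ x ∈ c, E.SmoothAt a x) : GeneratedAt (smoothConf (𝕂 := 𝕂) d)
      {g | ∃ a : E.Section, (∀ x ∈ c, E.SmoothAt a x) ∧ g = boxdotSection E d a}
      (boxdotSection E d a) c :=
  .of_mem isGermRing_smoothConf (Set.mem_ofPred.2 ⟨a, ha, rfl⟩) c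

/-- The `⊠`-multiplication of `S^⊠(E)` as a bundle map. -/
noncomputable def cauchySymMulMap {E : Family.{u, v, w} 𝕂 M}
    (hE : IsVectorBundle (smoothFun d) E) :
    BundleMap (cauchy d (cauchySym d E) (cauchySym d E)) (cauchySym d E) where
  toFun := cauchySymMul E d
  smooth s c hs := by
    rw [cauchySym_smoothAt_iff]
    refine (cauchy_smoothAt_iff.1 hs).map (F' := (cauchySym d E).Fib) isGermRing_smoothConf
      (cauchySymMul E d) ?_
    rintro _ ⟨A, a, b, hA, ha, hb, rfl⟩
    refine generatedAt_cauchySection (F := (cauchySym d E).Fib) hA (cauchySym_smoothAt_iff.1 ha)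
      (cauchySym_smoothAt_iff.1 hb) (cauchySymMul E d) ?_
    rintro _ ⟨α, hα, rfl⟩ _ ⟨β, hβ, rfl⟩
    -- The product of `⊡ α` on the part in `A` and `⊡ β` on the rest is `⊡` of the section equal to
    -- `α` on `A` and `β` off `A`. It is smooth at the points of `c` because none of them lies on
    -- the boundary of `A`.
    refine (generatedAt_boxdotSection (a := fun x => if x ∈ A then α x else β x)
      fun x hx => ?_).congr (.of_forall fun c' => ?_)
    · rcases hA x hx with h | h
      · refine hE.smoothAt_congr (hα x (mem_part.2 ⟨hx, mem_of_mem_nhds h⟩)) ?_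
        filter_upwards [h] with y hy using if_pos hy
      · refine hE.smoothAt_congr (hβ x (mem_part.2 ⟨hx, mem_of_mem_nhds h⟩)) ?_
        filter_upwards [h] with y hy using if_neg hy
    · exact cauchySymMul_inc_of_eq E d (splitBy A c')
        (fun x hx => if_pos (mem_part.1 hx).2) fun x hx => if_neg (mem_part.1 hx).2

variable (V : Family.{u, v, w} 𝕂 M)

/-- The `⊗`-multiplication of `S^⊠ S^⊗(V)` as a bundle map. -/
noncomputable def cauchyHadamardMulMap :
    BundleMap (hadamard (smoothConf d) (cauchyHadamard d V) (cauchyHadamard d V))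
      (cauchyHadamard d V) where
  toFun := cauchyHadamardMul d V
  smooth s c hs := by
    rw [cauchySym_smoothAt_iff]
    refine GeneratedAt.map (F' := (cauchyHadamard d V).Fib) isGermRing_smoothConf hs
      (cauchyHadamardMul d V) ?_
    rintro _ ⟨a, b, ha, hb, rfl⟩
    refine (cauchySym_smoothAt_iff.1 ha).map₂ (F'' := (cauchyHadamard d V).Fib)
      isGermRing_smoothConf (cauchySym_smoothAt_iff.1 hb) (fun c => TensorProduct.curry (cauchyHadamardMul d V c)) ?_
    rintro _ ⟨α, hα, rfl⟩ _ ⟨β, hβ, rfl⟩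
    refine (generatedAt_boxdotSection fun x hx => symBundle_smoothAt_mul isGermRing_smoothFun
      (hα x hx) (hβ x hx)).congr (.of_forall fun c' => ?_)
    exact cauchyHadamardMul_tmul d V α β c'

/-- The `⊗`-unit of `S^⊠ S^⊗(V)` as a bundle map. -/
noncomputable def cauchyHadamardOneMap :
    BundleMap (unitH (𝕂 := 𝕂) (M := M) d) (cauchyHadamard d V) where
  toFun := cauchyHadamardOne d V
  smooth s c hs := by
    rw [cauchySym_smoothAt_iff]
    exact (generatedAt_boxdotSection fun x _ =>
      symBundle_smoothAt_one isGermRing_smoothFun x).smul isGermRing_smoothConf hs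

/-- The presentation of `S^⊠(E)` by the products of sections. -/
noncomputable def cauchySymPresentation (E : Family.{u, v, w} 𝕂 M) :
    Presentation (cauchySym d E) E.Section where
  box := boxdotSection E d
  span c := by
    -- The quotient map by the span kills all products of sections, so it is zero by
    -- `cauchySym_ext`, and the span is everything.
    rw [← Submodule.ker_mkQ (Submodule.span 𝕂 (Set.range fun a => boxdotSection E d a c)),
      LinearMap.ker_eq_top]
    refine cauchySym_ext fun a => ?_
    exact (Submodule.Quotient.mk_eq_zero _).2 (Submodule.subset_span ⟨a, rfl⟩)
  glue h a b := by
    obtain ⟨e, h1, h2⟩ := exists_section_union E h a b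
    exact ⟨e, fun c hc => boxdotSection_congr E d fun x hx => h1 x (hc hx),
      fun c hc => boxdotSection_congr E d fun x hx => h2 x (hc hx)⟩

end Maps

/-! ### The 2-algebra bundle `S^⊠ S^⊗(V)` -/

section Main

variable {𝕂 : Type v} [RCLike 𝕂] {M : Type u} [TopologicalSpace M] [T2Space M] {d : ℕ}
  [ChartedSpace (EuclideanSpace ℝ (Fin d)) M]

/-- The structure of a 2-algebra bundle on `S^⊠ S^⊗(V)`. -/
noncomputable def cauchyHadamardTwoAlgebra (V : Family.{u, v, w} 𝕂 M)
    (hV : IsVectorBundle (smoothFun d) V) : TwoAlgebra d (cauchyHadamard d V) :=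
  Presentation.twoAlgebra (S := ∀ x, SymmetricAlgebra 𝕂 (V.Fib x))
    (cauchySymPresentation (symBundle (smoothFun d) V))
    (hV.symBundle isGermRing_smoothFun).cauchySym
    (cauchySymMulMap (hV.symBundle isGermRing_smoothFun)) (cauchyHadamardMulMap V)
    (cauchyHadamardOneMap V) (cauchySymMul_inc (symBundle (smoothFun d) V) d)
    (fun c a b => cauchyHadamardMul_tmul d V a b c) (fun c r => cauchyHadamardOne_apply d V c r)
    (fun _ _ => boxdotSection_congr (symBundle (smoothFun d) V) d
      fun x hx => absurd hx (Finset.notMem_empty x))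

theorem cauchyHadamardTwoAlgebra_isCommutative (V : Family.{u, v, w} 𝕂 M)
    (hV : IsVectorBundle (smoothFun d) V) : (cauchyHadamardTwoAlgebra V hV).IsCommutative :=
  ⟨Presentation.mulH_comm (S := ∀ x, SymmetricAlgebra 𝕂 (V.Fib x))
      (cauchySymPresentation (symBundle (smoothFun d) V))
      (fun c a b => cauchyHadamardMul_tmul d V a b c),
    Presentation.mulC_comm (cauchySymPresentation (symBundle (smoothFun d) V))
      (cauchySymMul_inc (symBundle (smoothFun d) V) d)⟩

end Main

end ConfBundle

open ConfBundle

theorem mainTheorem11 {𝕂 : Type*} [RCLike 𝕂] {d : ℕ} {M : Type*} [TopologicalSpace M] [T2Space M]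
    [ChartedSpace (EuclideanSpace ℝ (Fin d)) M] [IsManifold (𝓡 d) ∞ M]
    (V : Family 𝕂 M) (hV : IsVectorBundle (smoothFun d) V) :
    IsVectorBundle (smoothConf d)
      (hadamard (smoothConf d) (cauchyHadamard d V) (cauchyHadamard d V)) ∧
    IsVectorBundle (smoothConf d) (cauchy d (cauchyHadamard d V) (cauchyHadamard d V)) ∧
    ∃ T : TwoAlgebra d (cauchyHadamard d V), T.IsCommutative ∧
      -- the `⊠`-multiplication is `⊡`
      (∀ (c : UConf M) (s : Split c) (p : Labelling s.fst) (r : Labelling s.snd)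
        (a : ∀ x, SymmetricAlgebra 𝕂 (V.Fib x)),
        T.mulC.toFun c (inc (cauchyHadamard d V) (cauchyHadamard d V) s
          (boxdot d (symBundle (smoothFun d) V) a p ⊗ₜ[𝕂]
            boxdot d (symBundle (smoothFun d) V) a r)) =
          boxdot d (symBundle (smoothFun d) V) a (Labelling.append s p r)) ∧
      -- the `⊠`-unit is the class of the empty tensor
      (∀ (p : Labelling (∅ : UConf M)) (a : ∀ x, SymmetricAlgebra 𝕂 (V.Fib x)),
        T.unC.toFun ∅ (oneC 𝕂 ∅) = boxdot d (symBundle (smoothFun d) V) a p) ∧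
      -- the `⊗`-multiplication is the pointwise product of the symmetric algebras
      (∀ (c : UConf M) (p : Labelling c) (a b : ∀ x, SymmetricAlgebra 𝕂 (V.Fib x)),
        T.mulH.toFun c (boxdot d (symBundle (smoothFun d) V) a p ⊗ₜ[𝕂]
          boxdot d (symBundle (smoothFun d) V) b p) =
          boxdot d (symBundle (smoothFun d) V) (fun x => a x * b x) p) ∧
      -- the `⊗`-unit
      (∀ (c : UConf M) (p : Labelling c),
        T.oneH.toFun c (1 : 𝕂) = boxdot d (symBundle (smoothFun d) V) (fun _ => 1) p) := by
  have hA : IsVectorBundle (smoothConf d) (cauchyHadamard d V) :=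
    (hV.symBundle isGermRing_smoothFun).cauchySym
  refine ⟨hA.hadamard isGermRing_smoothConf hA, hA.cauchy hA, cauchyHadamardTwoAlgebra V hV,
    cauchyHadamardTwoAlgebra_isCommutative V hV, fun c s p r a => ?_, fun p a => ?_,
    fun c p a b => ?_, fun c p => ?_⟩
  · rw [boxdot_eq_section, boxdot_eq_section, boxdot_eq_section]
    exact cauchySymMul_inc (symBundle (smoothFun d) V) d s a
  -- Over the empty configuration the section is irrelevant, so it may be replaced by `1`, the
  -- section that gives the `⊗`-unit.
  · rw [boxdot_eq_section, boxdotSection_congr (b := fun _ => 1) _ d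
      fun x hx => absurd hx (Finset.notMem_empty x)]
    exact Presentation.un_oneC (S := ∀ x, SymmetricAlgebra 𝕂 (V.Fib x))
      (cauchySymPresentation (symBundle (smoothFun d) V))
      (fun c r => cauchyHadamardOne_apply d V c r)
  · rw [boxdot_eq_section, boxdot_eq_section, boxdot_eq_section]
    exact cauchyHadamardMul_tmul d V a b c
  · rw [boxdot_eq_section]
    exact one_smul 𝕂 _
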